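/- **Conventions.** A *lattice simplex* of dimension $d$ in $\mathbb{R}^d$ is the convex hull of $d+1$ affinely independent points of $\mathbb{Z}^d$. The *$\delta$-polynomial* of a lattice polytope $\mathcal P\subset\mathbb{R}^d$ of dimension $d$ is the polynomial $$\delta(\mathcal P,t)=(1-t)^{d+1}\Bigl(1+\sum_{n\ge 1}|n\mathcal P\cap\mathbb{Z}^d|\,t^n\Bigr).$$ Two lattice polytopes $\mathcal P,\mathcal Q\subset\mathbb{R}^d$ are *unimodularly equivalent* if $\mathcal Q=\{xU+w : x\in\mathcal P\}$ for some $U\in\mathbb{Z}^{d\times d}$ with $\det U=\pm1$ and some $w\in\mathbb{Z}^d$ (polytopes in spaces of different dimensions are not equivalent). A lattice simplex of dimension $d$ in $\mathbb{R}^d$ is a *lattice pyramid* over a lower-dimensional lattice simplex if it is unimodularly equivalent to $\operatorname{conv}\bigl(\mathcal Q\times\{0\}\cup\{(0,\dots,0,1)\}\bigr)$ for some lattice simplex $\mathcal Q\subset\mathbb{R}^{d-1}$ of dimension $d-1$. For integers $a_1,\dots,a_d$ and $A=(a_1,\dots,a_d)$, let $\Delta(A)\subset\mathbb{R}^d$ be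 the convex hull of the origin, the unit vectors $e_1,\dots,e_{d-1}$ and $(a_d-a_1,\dots,a_d-a_{d-1},a_d)$. For sequences of integers $B=(b_1,\dots,b_s)$ and $C=(c_1,\dots,c_d)$ with $1\le s<d$, let $\Delta(B,C)\subset\mathbb{R}^d$ be the convex hull of the origin, the unit vectors $e_i$ with $1\le i\le d$ and $i\ne s,d$, and the two points $(b_s-b_1,\dots,b_s-b_{s-1},b_s,0,\dots,0)$ and $(c_d-c_1,\dots,c_d-c_{d-1},c_d)$. **Corollary.** Let $p\neq q$ be prime numbers, let $k\ge 0$ be an integer, and let $\Delta\subset\mathbb{R}^d$ be a lattice simplex of dimension $d$ whose $\delta$-polynomial is $$1+t^{k+1}+t^{2(k+1)}+\cdots+t^{(pq-1)(k+1)}.$$ Suppose that $\Delta$ is not a lattice pyramid over any lower-dimensional lattice simplex. Then $\Delta$ is unimodularly equivalent to one of $\Delta(A_1)$, $\Delta(A_2)$, $\Delta(A_3)$, $\Delta(B_1,C_1)$ and $\Delta(B_2,C_2)$, where 1. $A_1=(\underbrace{1,\ldots,1}_{pq(k+1)-2},\,pq)$; 2. $B_1=(\underbrace{1,\ldots,1}_{p(k+1)-1},\,p)$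 and $C_1=(\underbrace{q,\ldots,q}_{p(k+1)},\,\underbrace{1,\ldots,1}_{pq(k+1)-2},\,q)$; 3. $B_2=(\underbrace{1,\ldots,1}_{q(k+1)-1},\,q)$ and $C_2=(\underbrace{p,\ldots,p}_{q(k+1)},\,\underbrace{1,\ldots,1}_{pq(k+1)-2},\,p)$; 4. $A_2=(\underbrace{1,\ldots,1}_{p(k+1)-1},\,\underbrace{p,\ldots,p}_{(pq-1)(k+1)-1},\,pq)$; 5. $A_3=(\underbrace{1,\ldots,1}_{q(k+1)-1},\,\underbrace{q,\ldots,q}_{(pq-1)(k+1)-1},\,pq)$. -/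

import Mathlib

open scoped Pointwise Matrix Polynomial

noncomputable section

/-- The real vector with the given integer coordinates. -/
def intVec {d : ℕ} (x : Fin d → ℤ) : Fin d → ℝ := fun i => (x i : ℝ)

/-- `P ⊂ ℝ^d` is a lattice simplex of dimension `d`: the convex hull of `d + 1` affinely
independent points of `ℤ^d`. -/
def IsLatticeSimplex {d : ℕ} (P : Set (Fin d → ℝ)) : Prop :=
  ∃ v : Fin (d + 1) → Fin d → ℤ,
    AffineIndependent ℝ (fun i => intVec (v i)) ∧
      P = convexHull ℝ (Set.range fun i => intVec (v i))

/-- The number `|nP ∩ ℤ^d|` of lattice points in the `n`-th dilate of `P`. -/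
def latticePointCount {d : ℕ} (P : Set (Fin d → ℝ)) (n : ℕ) : ℕ :=
  Set.ncard {x : Fin d → ℤ | intVec x ∈ (n : ℝ) • P}

/-- The series `1 + ∑_{n ≥ 1} |nP ∩ ℤ^d| t^n`. -/
def ehrhartSeries {d : ℕ} (P : Set (Fin d → ℝ)) : PowerSeries ℤ :=
  PowerSeries.mk fun n => if n = 0 then 1 else (latticePointCount P n : ℤ)

/-- `f` is the `δ`-polynomial of the `d`-dimensional lattice polytope `P ⊂ ℝ^d`:
`f(t) = (1 - t)^(d+1) * (1 + ∑_{n ≥ 1} |nP ∩ ℤ^d| t^n)` as formal power series. -/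
def IsDeltaPolynomial {d : ℕ} (P : Set (Fin d → ℝ)) (f : ℤ[X]) : Prop :=
  (f : PowerSeries ℤ) = (1 - PowerSeries.X) ^ (d + 1) * ehrhartSeries P

/-- `P ⊂ ℝ^d` and `Q ⊂ ℝ^e` are unimodularly equivalent: `d = e`, and `Q` is the image of `P`
under `x ↦ x U + w` for an integer matrix `U` of determinant `±1` and an integer vector `w`. -/
def UnimodularlyEquivalent {d e : ℕ} (P : Set (Fin d → ℝ)) (Q : Set (Fin e → ℝ)) : Prop :=
  ∃ (h : e = d) (U : Matrix (Fin d) (Fin d) ℤ) (w : Fin d → ℤ),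
    (U.det = 1 ∨ U.det = -1) ∧
      Q = (fun (x : Fin d → ℝ) (i : Fin e) =>
        (x ᵥ* U.map (Int.cast : ℤ → ℝ) + intVec w) (Fin.cast h i)) '' P

/-- The lattice pyramid `conv (P × {0} ∪ {(0, …, 0, 1)}) ⊂ ℝ^(d+1)` over `P ⊂ ℝ^d`. -/
def latticePyramid {d : ℕ} (P : Set (Fin d → ℝ)) : Set (Fin (d + 1) → ℝ) :=
  convexHull ℝ
    ((fun x : Fin d → ℝ => (Fin.snoc x 0 : Fin (d + 1) → ℝ)) '' P ∪ {Pi.single (Fin.last d) 1})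

/-- `P ⊂ ℝ^d` is, up to unimodular equivalence, the lattice pyramid over some lattice simplex
`Q ⊂ ℝ^(d-1)` of dimension `d - 1`. -/
def IsLatticePyramid {d : ℕ} (P : Set (Fin d → ℝ)) : Prop :=
  ∃ (e : ℕ) (Q : Set (Fin e → ℝ)),
    IsLatticeSimplex Q ∧ UnimodularlyEquivalent P (latticePyramid Q)

end

/-- For `A = (a_1, …, a_d)`, the `d × d` matrix whose first `d - 1` rows are those of the
identity matrix and whose last row is `(a_d - a_1, …, a_d - a_{d-1}, a_d)`. -/
def vertexMatrixA (A : List ℤ) : Matrix (Fin A.length) (Fin A.length) ℤ :=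
  Matrix.of fun i j =>
    if i.val + 1 = A.length then
      if j = i then A[i] else A[i] - A[j]
    else if i = j then 1 else 0

/-- For `B = (b_1, …, b_s)` and `C = (c_1, …, c_d)` with `1 ≤ s < d`, the `d × d` matrix whose
`s`-th row is `(b_s - b_1, …, b_s - b_{s-1}, b_s, 0, …, 0)`, whose last row is
`(c_d - c_1, …, c_d - c_{d-1}, c_d)`, and whose other rows are those of the identity matrix. -/
def vertexMatrixBC (B C : List ℤ) : Matrix (Fin C.length) (Fin C.length) ℤ :=
  Matrix.of fun i j =>
    if i.val + 1 = C.length then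
      if j = i then C[i] else C[i] - C[j]
    else if i.val + 1 = B.length then
      if j = i then B.getD i 0
      else if j < i then B.getD i 0 - B.getD j 0
      else 0
    else if i = j then 1 else 0

/-- The convex hull of the origin and the rows of an integer matrix. -/
def hullOriginRows {d : ℕ} (M : Matrix (Fin d) (Fin d) ℤ) : Set (Fin d → ℝ) :=
  convexHull ℝ (insert 0 (Set.range fun i => intVec (M i)))

/-- The polytope `Δ(A) ⊂ ℝ^d`, where `d` is the length of `A`. -/
def simplexA (A : List ℤ) : Set (Fin A.length → ℝ) :=
  hullOriginRows (vertexMatrixA A)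

/-- The polytope `Δ(B, C) ⊂ ℝ^d`, where `d` is the length of `C`. -/
def simplexBC (B C : List ℤ) : Set (Fin C.length → ℝ) :=
  hullOriginRows (vertexMatrixBC B C)

/-!
Barycentric coordinates modulo `1` of the lattice points turn the lattice modulo the vertices of
`Δ` into a finite subgroup `Λ` of `(ℝ / ℤ)^(d + 1)`, which determines `Δ` up to unimodular
equivalence. The fractional parts of the coordinates of `x ∈ Λ` add up to an integer, the height of
`x`, and the coefficient of `t^h` in the `δ`-polynomial counts the elements of height `h`. So here
the heights are the multiples `0, K, …, (p q - 1) K` of `K = k + 1`, each attained once, and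
dividing by `K` labels `Λ` by `{0, …, p q - 1}` subadditively. Such a labelling is very rigid:
either an element of label `1` generates `Λ`, with labels adding up without carrying, or the
elements of labels `1` and `p` (or `1` and `q`) are mixed-radix generators. The additivity of the
heights along these generators forces their coordinates to be `0`, `1 / p`, `1 / q` or `1 / (p q)`,
and since `Δ` is not a pyramid no coordinate vanishes on all of `Λ`. Counting coordinates with the
heights leaves exactly the groups of the five listed simplices.
-/

/-- The representative in `[0, 1)` of an element of `ℝ / ℤ`. -/
noncomputable def fracPart : UnitAddCircle → ℝ := (Int.fract_periodic ℝ).lift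

theorem fracPart_coe (r : ℝ) : fracPart r = Int.fract r := Function.Periodic.lift_coe _ r

theorem coe_unitAddCircle_eq_zero_iff {r : ℝ} :
    (r : UnitAddCircle) = 0 ↔ ∃ n : ℤ, (n : ℝ) = r := by
  simpa only [zsmul_one] using AddCircle.coe_eq_zero_iff (1 : ℝ) (x := r)

theorem coe_fracPart (x : UnitAddCircle) : (fracPart x : UnitAddCircle) = x := by
  induction x using QuotientAddGroup.induction_on with
  | H r =>
    rw [fracPart_coe, ← sub_eq_zero, ← AddCircle.coe_sub, coe_unitAddCircle_eq_zero_iff]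
    exact ⟨-⌊r⌋, by simp⟩

theorem coe_fracPart_add_natCast (x : UnitAddCircle) (m : ℕ) :
    ((fracPart x + m : ℝ) : UnitAddCircle) = x := by
  rw [AddCircle.coe_add, coe_fracPart, coe_unitAddCircle_eq_zero_iff.2 ⟨m, Int.cast_natCast m⟩,
    add_zero]

theorem fracPart_nonneg (x : UnitAddCircle) : 0 ≤ fracPart x := by
  induction x using QuotientAddGroup.induction_on with
  | H r => exact (Int.fract_nonneg r).trans_eq (fracPart_coe r).symm

theorem fracPart_lt_one (x : UnitAddCircle) : fracPart x < 1 := by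
  induction x using QuotientAddGroup.induction_on with
  | H r => exact (fracPart_coe r).trans_lt (Int.fract_lt_one r)

theorem floor_fracPart_add_natCast (x : UnitAddCircle) (m : ℕ) : ⌊fracPart x + m⌋₊ = m := by
  rw [Nat.floor_add_natCast (fracPart_nonneg x), Nat.floor_eq_zero.2 (fracPart_lt_one x), zero_add]

theorem fracPart_coe_add_floor {r : ℝ} (hr : 0 ≤ r) : fracPart r + ⌊r⌋₊ = r := by
  rw [fracPart_coe, natCast_floor_eq_intCast_floor hr, Int.fract_add_floor]

theorem fracPart_eq_zero {x : UnitAddCircle} : fracPart x = 0 ↔ x = 0 := by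
  refine ⟨fun h => ?_, fun h => ?_⟩
  · rw [← coe_fracPart x, h, AddCircle.coe_zero]
  · rw [h, ← AddCircle.coe_zero, fracPart_coe, Int.fract_zero]

theorem fracPart_coe_eq_self {r : ℝ} (h₀ : 0 ≤ r) (h₁ : r < 1) : fracPart r = r :=
  (fracPart_coe r).trans (Int.fract_eq_self.2 ⟨h₀, h₁⟩)

theorem fracPart_coe_le {r : ℝ} (hr : 0 ≤ r) : fracPart r ≤ r := by
  linarith [fracPart_coe_add_floor hr, Nat.cast_nonneg (α := ℝ) ⌊r⌋₊]

theorem fracPart_nsmul_add_nsmul_le (m n : ℕ) (x y : UnitAddCircle) :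
    fracPart (m • x + n • y) ≤ m * fracPart x + n * fracPart y := by
  have hx := fracPart_nonneg x
  have hy := fracPart_nonneg y
  have h := fracPart_coe_le (r := m • fracPart x + n • fracPart y) (by positivity)
  rwa [AddCircle.coe_add, AddCircle.coe_nsmul, AddCircle.coe_nsmul, coe_fracPart, coe_fracPart,
    nsmul_eq_mul, nsmul_eq_mul] at h

/-- The vectors of `(ℝ / ℤ)^ι` whose real lifts `x` make `∑ xᵢ (vᵢ, 1)` an integer vector: the
group `Λ_Δ` attached to the lattice simplex `Δ` with vertices `v`, for a given labelling of the
vertices. -/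
def vertexGroup {ι : Type*} [Fintype ι] {d : ℕ} (v : ι → Fin d → ℤ) :
    AddSubgroup (ι → UnitAddCircle) where
  carrier := {x | ∑ i, x i = 0 ∧ ∀ j, ∑ i, v i j • x i = 0}
  add_mem' := by
    rintro x y ⟨hx, hx'⟩ ⟨hy, hy'⟩
    simp only [Set.mem_ofPred_eq, Pi.add_apply, smul_add, Finset.sum_add_distrib]
    exact ⟨by rw [hx, hy, add_zero], fun j => by rw [hx', hy', add_zero]⟩
  zero_mem' := by simp
  neg_mem' := by
    rintro x ⟨hx, hx'⟩
    simp only [Set.mem_ofPred_eq, Pi.neg_apply, smul_neg, Finset.sum_neg_distrib]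
    exact ⟨by rw [hx, neg_zero], fun j => by rw [hx', neg_zero]⟩

/-- The lattice polytope spanned by the points `v`. -/
abbrev latticeHull {ι : Type*} {d : ℕ} (v : ι → Fin d → ℤ) : Set (Fin d → ℝ) :=
  convexHull ℝ (Set.range fun i => intVec (v i))

theorem intVec_injective {d : ℕ} : Function.Injective (intVec (d := d)) := fun _ _ h =>
  funext fun i => Int.cast_injective (congrFun h i)

section VertexGroup

variable {ι : Type*} [Fintype ι] {d : ℕ}

theorem mem_vertexGroup {v : ι → Fin d → ℤ} {x : ι → UnitAddCircle} :
    x ∈ vertexGroup v ↔ ∑ i, x i = 0 ∧ ∀ j, ∑ i, v i j • x i = 0 := Iff.rfl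

theorem sum_smul_intVec_apply (v : ι → Fin d → ℤ) (x : ι → ℝ) (j : Fin d) :
    (∑ i, x i • intVec (v i)) j = ∑ i, v i j • x i := by
  simp [intVec, Finset.sum_apply, mul_comm]

theorem coe_mem_vertexGroup {v : ι → Fin d → ℤ} {x : ι → ℝ} :
    (fun i => (x i : UnitAddCircle)) ∈ vertexGroup v ↔
      (∃ n : ℤ, (n : ℝ) = ∑ i, x i) ∧ ∃ z, intVec z = ∑ i, x i • intVec (v i) := by
  simp only [mem_vertexGroup, ← AddCircle.coe_zsmul, ← QuotientAddGroup.mk_sum]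
  rw [coe_unitAddCircle_eq_zero_iff]
  refine and_congr_right' ?_
  simp only [coe_unitAddCircle_eq_zero_iff, ← sum_smul_intVec_apply]
  rw [Classical.skolem]
  exact exists_congr fun z => funext_iff.symm

end VertexGroup

theorem eq_of_sum_smul_eq_of_affineIndependent {ι E : Type*} [Fintype ι] [AddCommGroup E]
    [Module ℝ E] {u : ι → E} (hu : AffineIndependent ℝ u) {x y : ι → ℝ}
    (h : ∑ i, x i = ∑ i, y i) (h' : ∑ i, x i • u i = ∑ i, y i • u i) : x = y := by
  funext i
  refine sub_eq_zero.1 (affineIndependent_iff.1 hu Finset.univ (fun i => x i - y i) ?_ ?_ i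
    (Finset.mem_univ i))
  · rw [Finset.sum_sub_distrib, h, sub_self]
  · simp only [sub_smul, Finset.sum_sub_distrib, h', sub_self]

/-- The square matrix with rows `(1, vᵢ)`. -/
def homogenization {d : ℕ} (v : Fin (d + 1) → Fin d → ℤ) : Matrix (Fin (d + 1)) (Fin (d + 1)) ℤ :=
  Matrix.of fun i => Fin.cons 1 (v i)

section Finite

variable {d : ℕ} {v : Fin (d + 1) → Fin d → ℤ}

theorem det_homogenization_ne_zero (hv : AffineIndependent ℝ fun i => intVec (v i)) :
    (homogenization v).det ≠ 0 := by
  intro hdet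
  obtain ⟨c, hc, hcv⟩ := Matrix.exists_vecMul_eq_zero_iff.2 hdet
  have hsum : ∑ i, c i = 0 := by
    simpa [homogenization, Matrix.vecMul, dotProduct] using congrFun hcv 0
  have hsmul (j : Fin d) : ∑ i, c i * v i j = 0 := by
    simpa [homogenization, Matrix.vecMul, dotProduct] using congrFun hcv j.succ
  refine hc (intVec_injective (eq_of_sum_smul_eq_of_affineIndependent (y := intVec 0) hv ?_ ?_))
  · simpa [intVec] using congrArg (Int.cast : ℤ → ℝ) hsum
  · funext j
    simpa [intVec] using congrArg (Int.cast : ℤ → ℝ) (hsmul j)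

theorem mem_vertexGroup_iff_homogenization {x : Fin (d + 1) → UnitAddCircle} :
    x ∈ vertexGroup v ↔ ∀ j, ∑ i, homogenization v i j • x i = 0 := by
  simp [Fin.forall_fin_succ, homogenization, mem_vertexGroup]

theorem det_zsmul_eq_zero_of_mem_vertexGroup {x : Fin (d + 1) → UnitAddCircle}
    (hx : x ∈ vertexGroup v) (k : Fin (d + 1)) : (homogenization v).det • x k = 0 := by
  have hcol := mem_vertexGroup_iff_homogenization.1 hx
  calc (homogenization v).det • x k
      = ∑ i, (homogenization v * (homogenization v).adjugate) i k • x i := by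
        simp [Matrix.mul_adjugate, Matrix.one_apply, ite_smul]
    _ = ∑ j, (homogenization v).adjugate j k • ∑ i, homogenization v i j • x i := by
        simp only [Matrix.mul_apply, Finset.sum_smul, Finset.smul_sum, smul_smul]
        rw [Finset.sum_comm]
        simp only [mul_comm]
    _ = 0 := by simp [hcol]

theorem finite_vertexGroup (hv : AffineIndependent ℝ fun i => intVec (v i)) :
    Finite (vertexGroup v) := by
  have hdet := Int.natAbs_pos.2 (det_homogenization_ne_zero hv)
  refine Set.Finite.subset (Set.Finite.pi' fun _ => AddCircle.finite_torsion (1 : ℝ) hdet) ?_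
  exact fun x hx k => natAbs_nsmul_eq_zero.2 (det_zsmul_eq_zero_of_mem_vertexGroup hx k)

theorem addMonoidHom_real_eq_zero {G : Type*} [AddCommGroup G] [Finite G] (φ : ℝ →+ G) :
    φ = 0 := by
  ext s
  have hs : s = Nat.card G • (s / Nat.card G) := by
    rw [nsmul_eq_mul, mul_div_cancel₀ _ (Nat.cast_ne_zero.2 Nat.card_pos.ne')]
  rw [hs, map_nsmul, card_nsmul_eq_zero', AddMonoidHom.zero_apply]

theorem eq_zero_of_forall_coe_mul_eq_zero {s : ℝ}
    (h : ∀ r : ℝ, ((r * s : ℝ) : UnitAddCircle) = 0) : s = 0 := by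
  by_contra hs
  have hhalf := h (2⁻¹ * s⁻¹)
  rw [inv_mul_cancel_right₀ hs] at hhalf
  have := fracPart_coe_eq_self (r := 2⁻¹) (by norm_num) (by norm_num)
  rw [hhalf, fracPart_eq_zero.2 rfl] at this
  norm_num at this

theorem affineIndependent_of_finite_vertexGroup {ι : Type*} [Fintype ι] {d : ℕ} {v : ι → Fin d → ℤ}
    [Finite (vertexGroup v)] : AffineIndependent ℝ fun i => intVec (v i) := by
  classical
  refine affineIndependent_iff.2 fun s c hc hcv => ?_
  let x : ι → ℝ := fun i => if i ∈ s then c i else 0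
  have hline (r : ℝ) : (fun i => ((r * x i : ℝ) : UnitAddCircle)) ∈ vertexGroup v := by
    refine coe_mem_vertexGroup.2 ⟨⟨0, ?_⟩, 0, ?_⟩
    · simp [x, ← Finset.mul_sum, hc]
    · simp only [mul_smul, ← Finset.smul_sum, x, ite_smul, zero_smul, Finset.sum_ite_mem,
        Finset.univ_inter, hcv, smul_zero]
      simp [intVec, funext_iff]
  let φ : ℝ →+ vertexGroup v := AddMonoidHom.mk' (fun r => ⟨_, hline r⟩) fun r r' => by
    ext i
    simp [add_mul]
  intro i hi
  suffices x i = 0 by simpa [x, hi] using this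
  exact eq_zero_of_forall_coe_mul_eq_zero fun r =>
    congrArg (fun g : vertexGroup v => g.1 i) (DFunLike.congr_fun (addMonoidHom_real_eq_zero φ) r)

end Finite

theorem mem_convexHull_range_iff {ι E : Type*} [Fintype ι] [AddCommGroup E] [Module ℝ E]
    (u : ι → E) (z : E) :
    z ∈ convexHull ℝ (Set.range u) ↔
      ∃ x : ι → ℝ, (∀ i, 0 ≤ x i) ∧ ∑ i, x i = 1 ∧ ∑ i, x i • u i = z := by
  classical
  have hu : Set.range u =
      Fintype.linearCombination ℝ u '' Set.range fun i => Pi.single i (1 : ℝ) := by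
    rw [← Set.range_comp]
    congr 1
    ext i
    simp
  rw [hu, ← LinearMap.image_convexHull, convexHull_rangle_single_eq_stdSimplex]
  simp [stdSimplex, Fintype.linearCombination_apply, and_assoc]

theorem mem_natCast_smul_convexHull_range_iff {ι E : Type*} [Fintype ι] [Nonempty ι]
    [AddCommGroup E] [Module ℝ E] (u : ι → E) (n : ℕ) (z : E) :
    z ∈ (n : ℝ) • convexHull ℝ (Set.range u) ↔
      ∃ x : ι → ℝ, (∀ i, 0 ≤ x i) ∧ ∑ i, x i = n ∧ ∑ i, x i • u i = z := by
  rcases Nat.eq_zero_or_pos n with rfl | hn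
  · rw [Nat.cast_zero, Set.zero_smul_set (Set.range_nonempty u).convexHull, Set.mem_zero]
    refine ⟨fun hz => ⟨0, by simp [hz]⟩, ?_⟩
    rintro ⟨x, hx, hsum, rfl⟩
    have hx0 := (Finset.sum_eq_zero_iff_of_nonneg fun i _ => hx i).1 hsum
    exact Finset.sum_eq_zero fun i hi => by rw [hx0 i hi, zero_smul]
  · have hn' : (0 : ℝ) < n := Nat.cast_pos.2 hn
    rw [Set.mem_smul_set_iff_inv_smul_mem₀ hn'.ne', mem_convexHull_range_iff]
    constructor
    · rintro ⟨x, hx, hsum, hz⟩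
      refine ⟨fun i => n * x i, fun i => mul_nonneg hn'.le (hx i), ?_, ?_⟩
      · rw [← Finset.mul_sum, hsum, mul_one]
      · simp only [mul_smul, ← Finset.smul_sum, hz, smul_inv_smul₀ hn'.ne']
    · rintro ⟨x, hx, hsum, rfl⟩
      refine ⟨fun i => (n : ℝ)⁻¹ * x i, fun i => by have := hx i; positivity, ?_, ?_⟩
      · rw [← Finset.mul_sum, hsum, inv_mul_cancel₀ hn'.ne']
      · simp only [mul_smul, Finset.smul_sum]

section Ehrhart

variable {ι : Type*} [Fintype ι] {d : ℕ}

/-- The sum of the representatives in `[0, 1)` of the coordinates, which is a natural number on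
`vertexGroup v`; the floor only serves to make it one by definition. -/
noncomputable def height (x : ι → UnitAddCircle) : ℕ := ⌊∑ i, fracPart (x i)⌋₊

theorem natCast_height {x : ι → UnitAddCircle} (hx : ∑ i, x i = 0) :
    (height x : ℝ) = ∑ i, fracPart (x i) := by
  have hcoe : ((∑ i, fracPart (x i) : ℝ) : UnitAddCircle) = 0 := by
    rw [QuotientAddGroup.mk_sum, ← hx]
    exact Finset.sum_congr rfl fun i _ => coe_fracPart (x i)
  obtain ⟨n, hn⟩ := coe_unitAddCircle_eq_zero_iff.1 hcoe
  have hnonneg : (0 : ℝ) ≤ n := hn ▸ Finset.sum_nonneg fun i _ => fracPart_nonneg (x i)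
  lift n to ℕ using mod_cast hnonneg
  simp [height, ← hn]

theorem natCast_height_add_sum {x : ι → UnitAddCircle} (hx : ∑ i, x i = 0) (m : ι → ℕ) :
    ((height x + ∑ i, m i : ℕ) : ℝ) = ∑ i, (fracPart (x i) + m i) := by
  rw [Nat.cast_add, natCast_height hx, Nat.cast_sum, Finset.sum_add_distrib]

/-- The barycentric coordinates, scaled by `n`, of the lattice points of the `n`-th dilate of the
simplex with vertices `v`. -/
def dilateCoords (v : ι → Fin d → ℤ) (n : ℕ) : Set (ι → ℝ) :=
  {x | (∀ i, 0 ≤ x i) ∧ ∑ i, x i = n ∧ ∃ z, intVec z = ∑ i, x i • intVec (v i)}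

theorem coe_mem_vertexGroup_of_mem_dilateCoords {v : ι → Fin d → ℤ} {n : ℕ} {x : ι → ℝ}
    (hx : x ∈ dilateCoords v n) : (fun i => (x i : UnitAddCircle)) ∈ vertexGroup v :=
  coe_mem_vertexGroup.2 ⟨⟨n, by simp [hx.2.1]⟩, hx.2.2⟩

theorem height_add_sum_floor_of_mem_dilateCoords {v : ι → Fin d → ℤ} {n : ℕ} {x : ι → ℝ}
    (hx : x ∈ dilateCoords v n) :
    height (fun i => (x i : UnitAddCircle)) + ∑ i, ⌊x i⌋₊ = n := by
  refine Nat.cast_injective (R := ℝ) ?_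
  rw [natCast_height_add_sum (coe_mem_vertexGroup_of_mem_dilateCoords hx).1, ← hx.2.1]
  exact Finset.sum_congr rfl fun i _ => fracPart_coe_add_floor (hx.1 i)

theorem fracPart_add_natCast_mem_dilateCoords {v : ι → Fin d → ℤ} {x : ι → UnitAddCircle}
    (hx : x ∈ vertexGroup v) {m : ι → ℕ} {n : ℕ} (hm : height x + ∑ i, m i = n) :
    (fun i => fracPart (x i) + m i) ∈ dilateCoords v n := by
  refine ⟨fun i => add_nonneg (fracPart_nonneg _) (Nat.cast_nonneg _),
    by rw [← hm, natCast_height_add_sum hx.1], (coe_mem_vertexGroup.1 ?_).2⟩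
  simpa only [coe_fracPart_add_natCast] using hx

/-- A lattice point of the `n`-th dilate amounts to the class of its scaled barycentric coordinates
modulo `ℤ` together with their integer parts. -/
noncomputable def dilateCoordsEquiv (v : ι → Fin d → ℤ) (n : ℕ) :
    dilateCoords v n ≃ Σ g : vertexGroup v, {m : ι → ℕ // height g.1 + ∑ i, m i = n} where
  toFun x := ⟨⟨_, coe_mem_vertexGroup_of_mem_dilateCoords x.2⟩,
    fun i => ⌊x.1 i⌋₊, height_add_sum_floor_of_mem_dilateCoords x.2⟩
  invFun gm := ⟨fun i => fracPart (gm.1.1 i) + gm.2.1 i,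
    fracPart_add_natCast_mem_dilateCoords gm.1.2 gm.2.2⟩
  left_inv x := Subtype.ext <| funext fun i => fracPart_coe_add_floor (x.2.1 i)
  right_inv gm := Sigma.subtype_ext
    (Subtype.ext <| funext fun i => coe_fracPart_add_natCast (gm.1.1 i) (gm.2.1 i))
    (funext fun i => floor_fracPart_add_natCast (gm.1.1 i) (gm.2.1 i))

theorem latticePointCount_latticeHull [Nonempty ι] {v : ι → Fin d → ℤ}
    (hv : AffineIndependent ℝ fun i => intVec (v i)) (n : ℕ) :
    latticePointCount (latticeHull v) n = Nat.card (dilateCoords v n) := by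
  have himage : intVec '' {z : Fin d → ℤ | intVec z ∈ (n : ℝ) • latticeHull v} =
      (fun x : ι → ℝ => ∑ i, x i • intVec (v i)) '' dilateCoords v n := by
    ext y
    constructor
    · rintro ⟨z, hz, rfl⟩
      obtain ⟨x, hx, hn, hxz⟩ := (mem_natCast_smul_convexHull_range_iff _ n _).1 hz
      exact ⟨x, ⟨hx, hn, z, hxz.symm⟩, hxz⟩
    · rintro ⟨x, ⟨hx, hn, z, hz⟩, rfl⟩
      exact ⟨z, (mem_natCast_smul_convexHull_range_iff _ n _).2 ⟨x, hx, hn, hz.symm⟩, hz⟩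
  have hinj : Set.InjOn (fun x : ι → ℝ => ∑ i, x i • intVec (v i)) (dilateCoords v n) :=
    fun x hx y hy h => eq_of_sum_smul_eq_of_affineIndependent hv (hx.2.1.trans hy.2.1.symm) h
  rw [latticePointCount, ← Set.ncard_image_of_injective _ intVec_injective, himage,
    hinj.ncard_image, Nat.card_coe_set_eq]

theorem latticePointCount_zero {P : Set (Fin d → ℝ)} (hP : P.Nonempty) :
    latticePointCount P 0 = 1 := by
  have hzero (z : Fin d → ℤ) : intVec z = 0 ↔ z = 0 := by
    simp [intVec, funext_iff]
  simp only [latticePointCount, Nat.cast_zero, Set.zero_smul_set hP, Set.mem_zero, hzero,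
    Set.ofPred_eq_eq_singleton, Set.ncard_singleton]

theorem coeff_X_pow_mul_mk_one_pow_card (h n : ℕ) :
    PowerSeries.coeff (R := ℤ) n (PowerSeries.X ^ h * PowerSeries.mk 1 ^ Fintype.card ι) =
      Nat.card {m : ι → ℕ // h + ∑ i, m i = n} := by
  classical
  rw [PowerSeries.coeff_X_pow_mul']
  split_ifs with hn
  · rw [← Finset.card_univ, ← Finset.prod_const, PowerSeries.coeff_prod]
    simp only [PowerSeries.coeff_mk, Pi.one_apply, Finset.prod_const_one, Finset.sum_const,
      nsmul_eq_mul, mul_one, Nat.cast_inj]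
    rw [← Fintype.card_coe, ← Nat.card_eq_fintype_card]
    refine Nat.card_congr (Finsupp.equivFunOnFinite.subtypeEquiv fun m => ?_)
    simp only [Finset.mem_finsuppAntidiag, Finset.subset_univ, and_true,
      Finsupp.equivFunOnFinite_apply]
    rw [eq_tsub_iff_add_eq_of_le hn, add_comm]
  · have : IsEmpty {m : ι → ℕ // h + ∑ i, m i = n} := ⟨fun m => hn (m.2 ▸ Nat.le_add_right _ _)⟩
    simp

theorem finite_subtype_add_sum_eq (h n : ℕ) : Finite {m : ι → ℕ // h + ∑ i, m i = n} :=
  (Set.Finite.pi' fun _ => Set.finite_Iic n).subset fun _ (hm : h + _ = n) i =>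
    (Finset.single_le_sum (fun _ _ => Nat.zero_le _) (Finset.mem_univ i)).trans
      (hm ▸ Nat.le_add_left _ _)

theorem ehrhartSeries_latticeHull [Nonempty ι] {v : ι → Fin d → ℤ} [Fintype (vertexGroup v)]
    (hv : AffineIndependent ℝ fun i => intVec (v i)) :
    ehrhartSeries (latticeHull v) =
      ∑ g : vertexGroup v, PowerSeries.X ^ height g.1 * PowerSeries.mk 1 ^ Fintype.card ι := by
  ext n
  have hcount : (latticePointCount (latticeHull v) n : ℤ) = PowerSeries.coeff n
      (∑ g : vertexGroup v,
        PowerSeries.X ^ height g.1 * (PowerSeries.mk 1 : PowerSeries ℤ) ^ Fintype.card ι) := by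
    have (g : vertexGroup v) : Finite {m : ι → ℕ // height g.1 + ∑ i, m i = n} :=
      finite_subtype_add_sum_eq _ n
    rw [latticePointCount_latticeHull hv, Nat.card_congr (dilateCoordsEquiv v n), Nat.card_sigma,
      map_sum, Nat.cast_sum]
    exact Finset.sum_congr rfl fun g _ => (coeff_X_pow_mul_mk_one_pow_card _ n).symm
  rw [← hcount, ehrhartSeries, PowerSeries.coeff_mk]
  split_ifs with hn
  · rw [hn, latticePointCount_zero (Set.range_nonempty _).convexHull, Nat.cast_one]
  · rfl

theorem eq_sum_X_pow_height_of_isDeltaPolynomial {v : Fin (d + 1) → Fin d → ℤ}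
    [Fintype (vertexGroup v)] (hv : AffineIndependent ℝ fun i => intVec (v i)) {f : ℤ[X]}
    (hf : IsDeltaPolynomial (latticeHull v) f) :
    f = ∑ g : vertexGroup v, Polynomial.X ^ height g.1 := by
  refine Polynomial.coe_injective ℤ ?_
  rw [hf, ehrhartSeries_latticeHull hv, Finset.mul_sum, ← Polynomial.coeToPowerSeries.ringHom_apply,
    map_sum]
  refine Finset.sum_congr rfl fun g _ => ?_
  rw [Fintype.card_fin, mul_left_comm, ← mul_pow, mul_comm (1 - _),
    PowerSeries.mk_one_mul_one_sub_eq_one, one_pow, mul_one]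
  simp

end Ehrhart

theorem coeff_sum_X_pow {α : Type*} [Fintype α] (f : α → ℕ) (n : ℕ) :
    (∑ a, (Polynomial.X : ℤ[X]) ^ f a).coeff n = Fintype.card {a // f a = n} := by
  simp [Polynomial.finsetSum_coeff, Polynomial.coeff_X_pow, Fintype.card_subtype, eq_comm]

theorem exists_equiv_of_sum_X_pow_eq {α β : Type*} [Fintype α] [Fintype β] {f : α → ℕ}
    {g : β → ℕ} (h : ∑ a, (Polynomial.X : ℤ[X]) ^ f a = ∑ b, Polynomial.X ^ g b) :
    ∃ e : α ≃ β, ∀ a, g (e a) = f a := by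
  have hfiber (n : ℕ) : Fintype.card {a // f a = n} = Fintype.card {b // g b = n} := by
    exact_mod_cast coeff_sum_X_pow f n ▸ coeff_sum_X_pow g n ▸ congrArg (Polynomial.coeff · n) h
  let e (n : ℕ) : {a // f a = n} ≃ {b // g b = n} := Fintype.equivOfCardEq (hfiber n)
  exact ⟨(Equiv.sigmaFiberEquiv f).symm.trans
    ((Equiv.sigmaCongrRight e).trans (Equiv.sigmaFiberEquiv g)), fun a => (e (f a) ⟨a, rfl⟩).2⟩

theorem eq_self_of_injOn_of_le {f : ℕ → ℕ} {n : ℕ} (hinj : Set.InjOn f (Set.Iio n))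
    (hle : ∀ i < n, f i ≤ i) : ∀ i < n, f i = i := by
  intro i
  induction i using Nat.strong_induction_on with
  | _ i ih =>
    intro hi
    by_contra hne
    have hlt : f i < i := lt_of_le_of_ne (hle i hi) hne
    exact hne (hinj (hlt.trans hi) hi (ih _ hlt (hlt.trans hi)))

theorem eq_and_eq_of_nsmul_add_nsmul_eq {G : Type*} [AddCommGroup G] {a b : G} {m m' l l' : ℕ}
    (hm : m < addOrderOf (b : G ⧸ AddSubgroup.zmultiples a))
    (hm' : m' < addOrderOf (b : G ⧸ AddSubgroup.zmultiples a))
    (hl : l < addOrderOf a) (hl' : l' < addOrderOf a)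
    (h : m • b + l • a = m' • b + l' • a) : m = m' ∧ l = l' := by
  have ha : (a : G ⧸ AddSubgroup.zmultiples a) = 0 :=
    (QuotientAddGroup.eq_zero_iff a).2 (AddSubgroup.mem_zmultiples a)
  have hquot := congrArg (QuotientAddGroup.mk (s := AddSubgroup.zmultiples a)) h
  simp only [QuotientAddGroup.mk_add, QuotientAddGroup.mk_nsmul, ha, smul_zero, add_zero] at hquot
  obtain rfl := nsmul_injOn_Iio_addOrderOf hm hm' hquot
  exact ⟨rfl, nsmul_injOn_Iio_addOrderOf hl hl' (add_left_cancel h)⟩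

theorem card_quotient_zmultiples {G : Type*} [AddCommGroup G] {p q : ℕ} {a : G} (hq : 0 < q)
    (hcard : Nat.card G = p * q) (hord : addOrderOf a = q) :
    Nat.card (G ⧸ AddSubgroup.zmultiples a) = p := by
  refine Nat.eq_of_mul_eq_mul_right hq ?_
  rw [← hcard, AddSubgroup.card_eq_card_quotient_mul_card_addSubgroup (AddSubgroup.zmultiples a),
    Nat.card_zmultiples, hord]

section SubadditiveLabelling

variable {G : Type*} [AddCommGroup G] {N : ℕ} {e : G ≃ Fin N}

theorem val_zero_of_subadditive (hadd : ∀ a b, (e (a + b) : ℕ) ≤ e a + e b) : (e 0 : ℕ) = 0 := by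
  let z := e.symm ⟨0, Fin.pos (e 0)⟩
  have hz : (e z : ℕ) = 0 := by simp [z]
  have hzz : z + z = z := e.injective (Fin.ext (by have := hadd z z; omega))
  rwa [add_eq_left.1 hzz] at hz

theorem val_nsmul_le_of_subadditive (hadd : ∀ a b, (e (a + b) : ℕ) ≤ e a + e b) (a : G) (n : ℕ) :
    (e (n • a) : ℕ) ≤ n * e a := by
  induction n with
  | zero => rw [zero_smul, zero_mul, val_zero_of_subadditive hadd]
  | succ n ih =>
    rw [succ_nsmul, add_mul, one_mul]
    exact (hadd _ _).trans (Nat.add_le_add_right ih _)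

theorem val_nsmul_eq_of_val_eq_one (hadd : ∀ a b, (e (a + b) : ℕ) ≤ e a + e b) {a : G}
    (ha : (e a : ℕ) = 1) : ∀ n < addOrderOf a, (e (n • a) : ℕ) = n :=
  eq_self_of_injOn_of_le
    (fun _ hn _ hn' h => nsmul_injOn_Iio_addOrderOf hn hn' (e.injective (Fin.ext h)))
    fun n _ => by simpa [ha] using val_nsmul_le_of_subadditive hadd a n

theorem val_lt_addOrderOf_of_mem_zmultiples (hadd : ∀ a b, (e (a + b) : ℕ) ≤ e a + e b) {a b : G}
    (ha : (e a : ℕ) = 1) (hfin : IsOfFinAddOrder a) (hb : b ∈ AddSubgroup.zmultiples a) :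
    (e b : ℕ) < addOrderOf a := by
  obtain ⟨n, rfl : n • a = b⟩ := hfin.mem_multiples_iff_mem_zmultiples.2 hb
  have hn := Nat.mod_lt n hfin.addOrderOf_pos
  rwa [← mod_addOrderOf_nsmul, val_nsmul_eq_of_val_eq_one hadd ha _ hn]

theorem exists_val_nsmul_add_nsmul_eq {p q : ℕ} (hp : p.Prime) (hq : 0 < q) (hN : N = p * q)
    (hadd : ∀ a b, (e (a + b) : ℕ) ≤ e a + e b) {a : G} (ha : (e a : ℕ) = 1)
    (hord : addOrderOf a = q) :
    ∃ b : G, p • b ∈ AddSubgroup.zmultiples a ∧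
      ∀ m < p, ∀ l < q, (e (m • b + l • a) : ℕ) = m * q + l := by
  have hqN : q < N := by nlinarith [hp.one_lt]
  let b := e.symm ⟨q, hqN⟩
  have hb : (e b : ℕ) = q := by simp [b]
  have hcard : Nat.card (G ⧸ AddSubgroup.zmultiples a) = p :=
    card_quotient_zmultiples hq (by rw [Nat.card_congr e, Nat.card_fin, hN]) hord
  have hpb : p • (b : G ⧸ AddSubgroup.zmultiples a) = 0 := hcard ▸ card_nsmul_eq_zero'
  have hordb : addOrderOf (b : G ⧸ AddSubgroup.zmultiples a) = p := by
    have := Fact.mk hp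
    refine addOrderOf_eq_prime hpb fun hzero => ?_
    have := val_lt_addOrderOf_of_mem_zmultiples hadd ha (addOrderOf_pos_iff.1 (hord ▸ hq))
      ((QuotientAddGroup.eq_zero_iff b).1 hzero)
    omega
  have hdigits : ∀ n < p * q, (e ((n / q) • b + (n % q) • a) : ℕ) = n := by
    refine eq_self_of_injOn_of_le (fun n hn n' hn' h => ?_) fun n _ => ?_
    · have hdiv {i : ℕ} (hi : i < p * q) : i / q < p := Nat.div_lt_of_lt_mul (mul_comm p q ▸ hi)
      have := eq_and_eq_of_nsmul_add_nsmul_eq (hordb.symm ▸ hdiv hn) (hordb.symm ▸ hdiv hn')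
        ((Nat.mod_lt n hq).trans_eq hord.symm) ((Nat.mod_lt n' hq).trans_eq hord.symm)
        (e.injective (Fin.ext h))
      rw [← Nat.div_add_mod n q, ← Nat.div_add_mod n' q, this.1, this.2]
    · calc (e ((n / q) • b + (n % q) • a) : ℕ) ≤ n / q * e b + n % q * e a :=
            (hadd _ _).trans (add_le_add (val_nsmul_le_of_subadditive hadd _ _)
              (val_nsmul_le_of_subadditive hadd _ _))
        _ = n := by rw [ha, hb, mul_one, Nat.div_add_mod']
  refine ⟨b, (QuotientAddGroup.eq_zero_iff _).1 hpb, fun m hm l hl => ?_⟩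
  have := hdigits (m * q + l) (by nlinarith)
  rwa [Nat.div_eq_of_lt_le (k := m) (by omega) (by nlinarith), mul_comm m, Nat.mul_add_mod,
    Nat.mod_eq_of_lt hl, mul_comm q] at this

/-- The label `1` is carried by an element of order `pq`, `q` or `p`. -/
theorem exists_val_eq_of_card_eq_mul {p q : ℕ} (hp : p.Prime) (hq : q.Prime) (hN : N = p * q)
    (hadd : ∀ a b, (e (a + b) : ℕ) ≤ e a + e b) :
    (∃ a : G, ∀ n < N, (e (n • a) : ℕ) = n) ∨
    (∃ a b : G, q • a = 0 ∧ p • b ∈ AddSubgroup.zmultiples a ∧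
      ∀ m < p, ∀ l < q, (e (m • b + l • a) : ℕ) = m * q + l) ∨
    (∃ a b : G, p • a = 0 ∧ q • b ∈ AddSubgroup.zmultiples a ∧
      ∀ m < q, ∀ l < p, (e (m • b + l • a) : ℕ) = m * p + l) := by
  have h1N : 1 < N := by nlinarith [hp.one_lt, hq.one_lt]
  obtain ⟨a, ha⟩ : ∃ a, (e a : ℕ) = 1 := ⟨e.symm ⟨1, h1N⟩, by simp⟩
  have hdvd : addOrderOf a ∣ p * q := by
    simpa [Nat.card_congr e, hN] using addOrderOf_dvd_natCard a
  obtain ⟨i, j, hi, hj, hij⟩ := (Nat.dvd_mul).1 hdvd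
  rcases (Nat.dvd_prime hp).1 hi with rfl | rfl <;> rcases (Nat.dvd_prime hq).1 hj with rfl | rfl
  · have ha0 : a = 0 := AddMonoid.addOrderOf_eq_one_iff.1 hij.symm
    rw [ha0, val_zero_of_subadditive hadd] at ha
    exact absurd ha zero_ne_one
  · rw [one_mul] at hij
    obtain ⟨b, hb⟩ := exists_val_nsmul_add_nsmul_eq hp hq.pos hN hadd ha hij.symm
    exact Or.inr (Or.inl ⟨a, b, hij ▸ addOrderOf_nsmul_eq_zero a, hb⟩)
  · rw [mul_one] at hij
    obtain ⟨b, hb⟩ := exists_val_nsmul_add_nsmul_eq hq hp.pos (by rw [hN, mul_comm]) hadd ha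
      hij.symm
    exact Or.inr (Or.inr ⟨a, b, hij ▸ addOrderOf_nsmul_eq_zero a, hb⟩)
  · exact Or.inl ⟨a, fun n hn => val_nsmul_eq_of_val_eq_one hadd ha n (hn.trans_eq (hN.trans hij))⟩

end SubadditiveLabelling

/-- The class of `1 / n` in `ℝ / ℤ`, which generates the `n`-torsion. -/
noncomputable def unitFraction (n : ℕ) : UnitAddCircle := ((1 / n : ℝ) : UnitAddCircle)

theorem fracPart_unitFraction {n : ℕ} (hn : 2 ≤ n) : fracPart (unitFraction n) = 1 / n := by
  have hn' : (1 : ℝ) < n := by exact_mod_cast hn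
  exact fracPart_coe_eq_self (by positivity) ((div_lt_one (by positivity)).2 hn')

theorem unitFraction_ne_zero {n : ℕ} (hn : 2 ≤ n) : unitFraction n ≠ 0 := fun h => by
  have hn' : (0 : ℝ) < 1 / n := by positivity
  rw [← fracPart_unitFraction hn, fracPart_eq_zero.2 h] at hn'
  exact hn'.false

theorem nsmul_unitFraction_mul {m n : ℕ} (hm : 0 < m) :
    m • unitFraction (m * n) = unitFraction n := by
  rw [unitFraction, unitFraction, ← AddCircle.coe_nsmul, nsmul_eq_mul, Nat.cast_mul]
  congr 1
  field_simp

theorem nsmul_eq_zero_iff_exists_nsmul_unitFraction {n : ℕ} (hn : 0 < n) {x : UnitAddCircle} :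
    n • x = 0 ↔ ∃ m < n, m • unitFraction n = x := by
  rw [AddCircle.nsmul_eq_zero_iff hn]
  refine exists_congr fun m => and_congr_right' ?_
  rw [unitFraction, ← AddCircle.coe_nsmul, nsmul_eq_mul, mul_one, mul_one_div]

theorem nsmul_eq_zero_iff_exists_zsmul_unitFraction {n : ℕ} (hn : 0 < n) {x : UnitAddCircle} :
    n • x = 0 ↔ ∃ m : ℤ, m • unitFraction n = x := by
  refine ⟨fun h => ?_, ?_⟩
  · obtain ⟨m, -, rfl⟩ := (nsmul_eq_zero_iff_exists_nsmul_unitFraction hn).1 h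
    exact ⟨m, natCast_zsmul _ _⟩
  · rintro ⟨m, rfl⟩
    rw [smul_comm, unitFraction, ← AddCircle.coe_nsmul, nsmul_eq_mul, mul_one_div_cancel
      (by positivity), coe_unitAddCircle_eq_zero_iff.2 ⟨1, Int.cast_one⟩, smul_zero]

theorem eq_zero_or_eq_unitFraction {p n : ℕ} (hp : 2 ≤ p) (hn : 0 < n) {x : UnitAddCircle}
    (htor : (p * n) • x = 0) (hlt : ((p - 1 : ℕ) : ℝ) * (n * fracPart x) < 1) :
    x = 0 ∨ x = unitFraction (p * n) := by
  obtain ⟨m, hm, rfl⟩ :=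
    (nsmul_eq_zero_iff_exists_nsmul_unitFraction (Nat.mul_pos (by omega) hn)).1 htor
  have hm1 : m < 2 := by
    have hfrac : fracPart (m • unitFraction (p * n)) = m / (p * n) := by
      have hm' : (m : ℝ) < p * n := by exact_mod_cast hm
      rw [unitFraction, ← AddCircle.coe_nsmul, nsmul_eq_mul, mul_one_div, Nat.cast_mul]
      exact fracPart_coe_eq_self (by positivity) ((div_lt_one (by positivity)).2 hm')
    rw [hfrac] at hlt
    field_simp at hlt
    have hlt' : (p - 1) * m < p := by exact_mod_cast hlt
    by_contra! h2
    have := Nat.mul_le_mul_left (p - 1) h2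
    omega
  interval_cases m
  · exact Or.inl (zero_smul _ _)
  · exact Or.inr (one_smul _ _)

section Coordinates

variable {ι : Type*} [Fintype ι]

theorem natCast_height_nsmul_add_nsmul {x y : ι → UnitAddCircle} (hx : ∑ i, x i = 0)
    (hy : ∑ i, y i = 0) (m n : ℕ) :
    (height (m • x + n • y) : ℝ) = ∑ i, fracPart (m • x i + n • y i) :=
  natCast_height (by
    simp only [Pi.add_apply, Pi.smul_apply, Finset.sum_add_distrib, ← Finset.smul_sum, hx, hy,
      smul_zero, add_zero])

theorem natCast_mul_height_add_mul_height {x y : ι → UnitAddCircle} (hx : ∑ i, x i = 0)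
    (hy : ∑ i, y i = 0) (m n : ℕ) :
    ((m * height x + n * height y : ℕ) : ℝ) = ∑ i, (m * fracPart (x i) + n * fracPart (y i)) := by
  rw [Nat.cast_add, Nat.cast_mul, Nat.cast_mul, natCast_height hx, natCast_height hy,
    Finset.mul_sum, Finset.mul_sum, Finset.sum_add_distrib]

theorem height_nsmul_add_nsmul_le {x y : ι → UnitAddCircle} (hx : ∑ i, x i = 0)
    (hy : ∑ i, y i = 0) (m n : ℕ) :
    height (m • x + n • y) ≤ m * height x + n * height y := by
  rw [← Nat.cast_le (α := ℝ), natCast_height_nsmul_add_nsmul hx hy,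
    natCast_mul_height_add_mul_height hx hy]
  exact Finset.sum_le_sum fun i _ => fracPart_nsmul_add_nsmul_le m n (x i) (y i)

/-- Equality in `height_nsmul_add_nsmul_le` forces equality in every coordinate. -/
theorem mul_fracPart_add_mul_fracPart_lt_one {x y : ι → UnitAddCircle} (hx : ∑ i, x i = 0)
    (hy : ∑ i, y i = 0) {m n : ℕ}
    (h : height (m • x + n • y) = m * height x + n * height y) (i : ι) :
    m * fracPart (x i) + n * fracPart (y i) < 1 := by
  have hsum := congrArg (Nat.cast (R := ℝ)) h
  rw [natCast_height_nsmul_add_nsmul hx hy, natCast_mul_height_add_mul_height hx hy] at hsum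
  rw [← (Finset.sum_eq_sum_iff_of_le fun i _ =>
    fracPart_nsmul_add_nsmul_le m n (x i) (y i)).1 hsum i (Finset.mem_univ i)]
  exact fracPart_lt_one _

theorem eq_unitFraction_of_height_eq {p : ℕ} (hp : 2 ≤ p) {a : ι → UnitAddCircle}
    (hsum : ∑ i, a i = 0) (htor : p • a = 0) (hne : ∀ i, a i ≠ 0)
    (hht : height ((p - 1) • a) = (p - 1) * height a) (i : ι) : a i = unitFraction p := by
  have hlt := mul_fracPart_add_mul_fracPart_lt_one (m := p - 1) (n := 0) hsum hsum
    (by simpa using hht) i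
  have := eq_zero_or_eq_unitFraction hp one_pos (x := a i) (by simpa using congrFun htor i)
    (by simpa using hlt)
  simpa using this.resolve_left (hne i)

section TwoGenerators

variable {p q : ℕ} {a b : ι → UnitAddCircle}

theorem eq_zero_or_eq_unitFraction_of_height_eq (hq : 2 ≤ q) (ha : ∑ i, a i = 0)
    (hb : ∑ i, b i = 0) (hqa : q • a = 0)
    (hht : height ((p - 1) • b + (q - 1) • a) = (p - 1) * height b + (q - 1) * height a) (i : ι) :
    a i = 0 ∨ a i = unitFraction q := by
  have hlt := mul_fracPart_add_mul_fracPart_lt_one hb ha hht i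
  have hnonneg := mul_nonneg (Nat.cast_nonneg (α := ℝ) (p - 1)) (fracPart_nonneg (b i))
  have := eq_zero_or_eq_unitFraction hq one_pos (x := a i) (by simpa using congrFun hqa i)
    (by rw [Nat.cast_one, one_mul]; linarith)
  simpa using this

theorem eq_unitFraction_of_apply_eq_zero (hp : 2 ≤ p) (ha : ∑ i, a i = 0) (hb : ∑ i, b i = 0)
    {c : ℤ} (hpb : p • b = c • a)
    (hht : height ((p - 1) • b + (q - 1) • a) = (p - 1) * height b + (q - 1) * height a) {i : ι}
    (hai : a i = 0) (hbi : b i ≠ 0) : b i = unitFraction p := by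
  have hlt := mul_fracPart_add_mul_fracPart_lt_one hb ha hht i
  rw [hai, fracPart_eq_zero.2 rfl, mul_zero, add_zero] at hlt
  have := eq_zero_or_eq_unitFraction hp one_pos (x := b i)
    (by simpa [hai] using congrFun hpb i) (by simpa using hlt)
  simpa using this.resolve_left hbi

theorem eq_zero_or_eq_unitFraction_mul (hp : 2 ≤ p) (hq : 2 ≤ q) (ha : ∑ i, a i = 0)
    (hb : ∑ i, b i = 0) (hqa : q • a = 0) {c : ℤ} (hpb : p • b = c • a)
    (hht : height ((p - 1) • b + (q - 1) • a) = (p - 1) * height b + (q - 1) * height a) {i : ι}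
    (hai : a i = unitFraction q) : b i = 0 ∨ b i = unitFraction (p * q) := by
  have hlt := mul_fracPart_add_mul_fracPart_lt_one hb ha hht i
  have hq' : (2 : ℝ) ≤ q := by exact_mod_cast hq
  rw [hai, fracPart_unitFraction hq, Nat.cast_sub (by omega : 1 ≤ q), Nat.cast_one] at hlt
  refine eq_zero_or_eq_unitFraction hp (by omega) ?_ ?_
  · have htor : (p * q) • b = 0 := by
      rw [mul_comm, mul_smul, hpb, smul_comm, hqa, smul_zero]
    simpa using congrFun htor i
  · field_simp at hlt
    linarith

theorem exists_finset_eq_ite_of_height_eq [DecidableEq ι] (hp : 2 ≤ p) (hq : 2 ≤ q)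
    (ha : ∑ i, a i = 0) (hb : ∑ i, b i = 0) (hqa : q • a = 0) {c : ℤ} (hpb : p • b = c • a)
    (hht : height ((p - 1) • b + (q - 1) • a) = (p - 1) * height b + (q - 1) * height a)
    (hne : ∀ i, a i = 0 → b i ≠ 0) :
    ∃ T : Finset ι, (a = fun i => if i ∈ T then unitFraction q else 0) ∧
      ((b = fun i => if i ∈ T then unitFraction (p * q) else unitFraction p) ∨
        b = fun i => if i ∈ T then 0 else unitFraction p) := by
  classical
  have hT (i : ι) : i ∈ Finset.univ.filter (a · ≠ 0) ↔ a i ≠ 0 := by simp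
  have haT (i : ι) (hi : a i ≠ 0) : a i = unitFraction q :=
    (eq_zero_or_eq_unitFraction_of_height_eq hq ha hb hqa hht i).resolve_left hi
  have hbT (i : ι) (hi : a i = 0) : b i = unitFraction p :=
    eq_unitFraction_of_apply_eq_zero hp ha hb hpb hht hi (hne i hi)
  have hpbT (i : ι) (hi : a i ≠ 0) : p • b i = c • unitFraction q := by
    rw [← haT i hi]
    exact congrFun hpb i
  have hpq : p • unitFraction (p * q) = unitFraction q := nsmul_unitFraction_mul (by omega)
  have hbT' (i : ι) (hi : a i ≠ 0) : b i = 0 ∨ b i = unitFraction (p * q) :=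
    eq_zero_or_eq_unitFraction_mul hp hq ha hb hqa hpb hht (haT i hi)
  refine ⟨Finset.univ.filter (a · ≠ 0), funext fun i => ?_, ?_⟩
  · split_ifs with hi
    · exact haT i ((hT i).1 hi)
    · exact not_not.1 (mt (hT i).2 hi)
  by_cases hc : c • unitFraction q = 0
  · refine Or.inr (funext fun i => ?_)
    split_ifs with hi
    · refine (hbT' i ((hT i).1 hi)).resolve_right fun h => unitFraction_ne_zero hq ?_
      rw [← hpq, ← h, hpbT i ((hT i).1 hi), hc]
    · exact hbT i (not_not.1 (mt (hT i).2 hi))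
  · refine Or.inl (funext fun i => ?_)
    split_ifs with hi
    · refine (hbT' i ((hT i).1 hi)).resolve_left fun h => hc ?_
      rw [← hpbT i ((hT i).1 hi), h, smul_zero]
    · exact hbT i (not_not.1 (mt (hT i).2 hi))

end TwoGenerators

end Coordinates

section Models

variable {ι : Type*} [DecidableEq ι]

/-- The cyclic group of vectors in `(ℝ / ℤ)^ι` with coordinates `t` on `T` and `r t` off `T`, where
`t` is `n`-torsion. -/
noncomputable def cyclicSubgroup (T : Finset ι) (r n : ℕ) : AddSubgroup (ι → UnitAddCircle) :=
  AddSubgroup.zmultiples fun i => if i ∈ T then unitFraction n else r • unitFraction n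

/-- The group of vectors in `(ℝ / ℤ)^ι` which have a constant `m`-torsion value on `T` and a
constant `n`-torsion value off `T`. -/
noncomputable def splitSubgroup (T : Finset ι) (m n : ℕ) : AddSubgroup (ι → UnitAddCircle) :=
  AddSubgroup.closure
    {fun i => if i ∈ T then 0 else unitFraction n, fun i => if i ∈ T then unitFraction m else 0}

theorem mem_cyclicSubgroup {T : Finset ι} {r n : ℕ} (hn : 0 < n) {x : ι → UnitAddCircle} :
    x ∈ cyclicSubgroup T r n ↔ ∃ t, n • t = 0 ∧ ∀ i, x i = if i ∈ T then t else r • t := by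
  simp only [cyclicSubgroup, AddSubgroup.mem_zmultiples_iff,
    nsmul_eq_zero_iff_exists_zsmul_unitFraction hn, exists_exists_eq_and]
  refine exists_congr fun m => funext_iff.trans (forall_congr' fun i => ?_)
  rw [eq_comm, Pi.smul_apply, smul_ite, smul_comm m r]

theorem mem_splitSubgroup {T : Finset ι} {m n : ℕ} (hm : 0 < m) (hn : 0 < n)
    {x : ι → UnitAddCircle} :
    x ∈ splitSubgroup T m n ↔
      ∃ s t, m • s = 0 ∧ n • t = 0 ∧ ∀ i, x i = if i ∈ T then s else t := by
  simp only [splitSubgroup, AddSubgroup.mem_closure_pair,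
    nsmul_eq_zero_iff_exists_zsmul_unitFraction hm, nsmul_eq_zero_iff_exists_zsmul_unitFraction hn,
    exists_and_left, exists_exists_eq_and]
  rw [exists_comm]
  refine exists_congr fun k => exists_congr fun l => funext_iff.trans (forall_congr' fun i => ?_)
  rw [eq_comm, Pi.add_apply, Pi.smul_apply, Pi.smul_apply, smul_ite, smul_ite, smul_zero, smul_zero,
    ite_add_ite, add_zero, zero_add]

theorem cyclicSubgroup_one (T : Finset ι) (n : ℕ) :
    cyclicSubgroup T 1 n = AddSubgroup.zmultiples fun _ => unitFraction n := by
  simp [cyclicSubgroup]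

theorem closure_eq_cyclicSubgroup {T : Finset ι} {p q : ℕ} (hp : 0 < p) (hq : 0 < q) :
    AddSubgroup.closure {fun i => if i ∈ T then unitFraction (p * q) else unitFraction p,
      fun i => if i ∈ T then unitFraction q else 0} = cyclicSubgroup T q (p * q) := by
  have hqp : q • unitFraction (p * q) = unitFraction p := by
    rw [mul_comm, nsmul_unitFraction_mul hq]
  have hp_smul : (fun i => if i ∈ T then unitFraction q else 0) =
      p • fun i => if i ∈ T then unitFraction (p * q) else unitFraction p := by
    funext i
    rw [Pi.smul_apply, smul_ite, nsmul_unitFraction_mul hp,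
      (nsmul_eq_zero_iff_exists_zsmul_unitFraction hp).2 ⟨1, one_smul _ _⟩]
  simp only [cyclicSubgroup, hp_smul, hqp]
  rw [AddSubgroup.zmultiples_eq_closure fun i =>
    if i ∈ T then unitFraction (p * q) else unitFraction p]
  refine le_antisymm ((AddSubgroup.closure_le _).2 ?_)
    (AddSubgroup.closure_mono (Set.singleton_subset_iff.2 (Set.mem_insert _ _)))
  rintro _ (rfl | rfl)
  · exact AddSubgroup.mem_closure_singleton_self _
  · exact nsmul_mem (AddSubgroup.mem_closure_singleton_self _) p

variable [Fintype ι]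

theorem natCast_height_ite {T : Finset ι} {s t : UnitAddCircle}
    (h : ∑ i, (if i ∈ T then s else t) = 0) :
    (height (fun i => if i ∈ T then s else t) : ℝ) =
      T.card * fracPart s + (Fintype.card ι - T.card) * fracPart t := by
  rw [natCast_height h, ← Finset.sum_add_sum_compl T,
    Finset.sum_congr rfl fun i hi => by rw [if_pos hi],
    Finset.sum_congr (s₁ := Tᶜ) rfl fun i hi => by rw [if_neg (Finset.mem_compl.1 hi)]]
  simp only [Finset.sum_const, nsmul_eq_mul, Finset.card_compl,
    Nat.cast_sub (Finset.card_le_univ T)]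

theorem card_eq_mul_of_height_ite_zero {T : Finset ι} {q K : ℕ} (hq : 2 ≤ q)
    (hsum : ∑ i, (if i ∈ T then unitFraction q else 0) = 0)
    (hK : height (fun i => if i ∈ T then unitFraction q else 0) = K) : T.card = q * K := by
  have h := natCast_height_ite hsum
  rw [hK, fracPart_unitFraction hq, fracPart_eq_zero.2 rfl] at h
  field_simp at h
  rw [← Nat.cast_inj (R := ℝ)]
  push_cast
  linarith

theorem closure_eq_cyclicSubgroup_or_splitSubgroup {p q K : ℕ} (hp : 2 ≤ p) (hq : 2 ≤ q)
    {a b : ι → UnitAddCircle} (ha : ∑ i, a i = 0) (hb : ∑ i, b i = 0) (hqa : q • a = 0) {c : ℤ}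
    (hpb : p • b = c • a) (hKa : height a = K) (hKb : height b = q * K)
    (hht : height ((p - 1) • b + (q - 1) • a) = (p - 1) * height b + (q - 1) * height a)
    (hne : ∀ i, a i = 0 → b i ≠ 0) :
    ∃ T : Finset ι, T.card = q * K ∧
      ((Fintype.card ι = q * K + (p * q - 1) * K ∧
          AddSubgroup.closure {b, a} = cyclicSubgroup T q (p * q)) ∨
        (Fintype.card ι = q * K + p * q * K ∧
          AddSubgroup.closure {b, a} = splitSubgroup T q p)) := by
  obtain ⟨T, rfl, hbT⟩ := exists_finset_eq_ite_of_height_eq hp hq ha hb hqa hpb hht hne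
  have hT := card_eq_mul_of_height_ite_zero hq ha hKa
  have : (q : ℝ) ≠ 0 := by positivity
  refine ⟨T, hT, ?_⟩
  rcases hbT with rfl | rfl
  · refine Or.inl ⟨?_, closure_eq_cyclicSubgroup (by omega) (by omega)⟩
    have h := natCast_height_ite hb
    rw [hKb, hT, fracPart_unitFraction hp, fracPart_unitFraction (by nlinarith)] at h
    have hpq : 1 ≤ p * q := by nlinarith
    rw [← Nat.cast_inj (R := ℝ)]
    push_cast [hpq] at h ⊢
    field_simp at h
    linarith
  · refine Or.inr ⟨?_, rfl⟩
    have h := natCast_height_ite hb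
    rw [hKb, hT, fracPart_unitFraction hp, fracPart_eq_zero.2 rfl] at h
    rw [← Nat.cast_inj (R := ℝ)]
    push_cast at h ⊢
    field_simp at h
    linarith

end Models

theorem card_eq_mul_of_height_const {ι : Type*} [Fintype ι] {N K : ℕ} (hN : 2 ≤ N)
    (hsum : ∑ _ : ι, unitFraction N = 0)
    (hK : height (fun _ : ι => unitFraction N) = K) : Fintype.card ι = N * K := by
  classical
  simpa using card_eq_mul_of_height_ite_zero (T := (Finset.univ : Finset ι)) hN
    (by simpa using hsum) (by simpa using hK)

theorem apply_ne_zero_of_mem_closure_pair {ι : Type*} {a b : ι → UnitAddCircle}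
    (h : ∀ i, ∃ x ∈ AddSubgroup.closure {b, a}, x i ≠ 0) (i : ι) (hi : a i = 0) : b i ≠ 0 := by
  obtain ⟨x, hx, hxi⟩ := h i
  obtain ⟨m, n, rfl⟩ := AddSubgroup.mem_closure_pair.1 hx
  contrapose! hxi
  simp [hi, hxi]

section Classification

variable {ι : Type*} [Fintype ι] {Λ : AddSubgroup (ι → UnitAddCircle)} {N K : ℕ} {e : Λ ≃ Fin N}

theorem val_add_le_of_mul_eq_height (hΛ : ∀ x ∈ Λ, ∑ i, x i = 0) (hK : 0 < K)
    (he : ∀ x, (e x : ℕ) * K = height x.1) (x y : Λ) : (e (x + y) : ℕ) ≤ e x + e y := by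
  refine Nat.le_of_mul_le_mul_right ?_ hK
  rw [add_mul, he, he, he]
  simpa using height_nsmul_add_nsmul_le (hΛ x x.2) (hΛ y y.2) 1 1

theorem eq_zmultiples_unitFraction (hΛ : ∀ x ∈ Λ, ∑ i, x i = 0) (hN : 2 ≤ N)
    (he : ∀ x, (e x : ℕ) * K = height x.1) (hne : ∀ i, ∃ x ∈ Λ, x i ≠ 0) {a : Λ}
    (ha : ∀ n < N, (e (n • a) : ℕ) = n) :
    Fintype.card ι = N * K ∧ Λ = AddSubgroup.zmultiples fun _ => unitFraction N := by
  have hgen : Λ = AddSubgroup.zmultiples a.1 := by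
    refine le_antisymm (fun x hx => ?_) (AddSubgroup.zmultiples_le_of_mem a.2)
    have hxa : (e ⟨x, hx⟩ : ℕ) • a = ⟨x, hx⟩ := e.injective (Fin.ext (ha _ (e _).2))
    exact ⟨e ⟨x, hx⟩, by simpa using congrArg Subtype.val hxa⟩
  have htor : N • a.1 = 0 := by
    have : Nat.card Λ = N := by rw [Nat.card_congr e, Nat.card_fin]
    have hNa : N • a = 0 := this ▸ card_nsmul_eq_zero'
    simpa using congrArg Subtype.val hNa
  have hht (n : ℕ) (hn : n < N) : height (n • a.1) = n * K := by
    simpa [ha n hn] using (he (n • a)).symm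
  have hKa : height a.1 = K := by simpa using hht 1 (by omega)
  have hne' (i : ι) : a.1 i ≠ 0 := by
    obtain ⟨x, hx, hxi⟩ := hne i
    obtain ⟨n, rfl⟩ := AddSubgroup.mem_zmultiples_iff.1 (hgen ▸ hx)
    exact fun hi => hxi (by rw [Pi.smul_apply, hi, smul_zero])
  have hconst : a.1 = fun _ => unitFraction N :=
    funext (eq_unitFraction_of_height_eq hN (hΛ a a.2) htor hne'
      (by rw [hht _ (by omega), hKa]))
  refine ⟨card_eq_mul_of_height_const hN ?_ (hconst ▸ hKa), hconst ▸ hgen⟩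
  simpa [hconst] using hΛ a a.2

variable [DecidableEq ι]

theorem eq_cyclicSubgroup_or_eq_splitSubgroup {p q : ℕ} (hΛ : ∀ x ∈ Λ, ∑ i, x i = 0) (hp : 2 ≤ p)
    (hq : 2 ≤ q) (hN : N = p * q) (he : ∀ x, (e x : ℕ) * K = height x.1)
    (hne : ∀ i, ∃ x ∈ Λ, x i ≠ 0) {a b : Λ} (hqa : q • a = 0)
    (hpb : p • b ∈ AddSubgroup.zmultiples a)
    (hab : ∀ m < p, ∀ l < q, (e (m • b + l • a) : ℕ) = m * q + l) :
    ∃ T : Finset ι, T.card = q * K ∧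
      ((Fintype.card ι = q * K + (p * q - 1) * K ∧ Λ = cyclicSubgroup T q (p * q)) ∨
        (Fintype.card ι = q * K + p * q * K ∧ Λ = splitSubgroup T q p)) := by
  have hgen : Λ = AddSubgroup.closure {b.1, a.1} := by
    refine le_antisymm (fun x hx => ?_) ((AddSubgroup.closure_le _).2 ?_)
    · have hlt : (e ⟨x, hx⟩ : ℕ) / q < p :=
        Nat.div_lt_of_lt_mul ((e _).2.trans_eq (hN.trans (mul_comm p q)))
      have hx' : ((e ⟨x, hx⟩ : ℕ) / q) • b + ((e ⟨x, hx⟩ : ℕ) % q) • a = ⟨x, hx⟩ :=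
        e.injective (Fin.ext (by rw [hab _ hlt _ (Nat.mod_lt _ (by omega)), Nat.div_add_mod']))
      exact AddSubgroup.mem_closure_pair.2 ⟨((e ⟨x, hx⟩ : ℕ) / q : ℕ), ((e ⟨x, hx⟩ : ℕ) % q : ℕ),
        by rw [natCast_zsmul, natCast_zsmul]; exact congrArg Subtype.val hx'⟩
    · rintro _ (rfl | rfl)
      exacts [b.2, a.2]
  have hht (m : ℕ) (hm : m < p) (l : ℕ) (hl : l < q) :
      height (m • b.1 + l • a.1) = (m * q + l) * K := by
    simpa [hab m hm l hl] using (he (m • b + l • a)).symm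
  have hKa : height a.1 = K := by simpa using hht 0 (by omega) 1 (by omega)
  have hKb : height b.1 = q * K := by simpa using hht 1 (by omega) 0 (by omega)
  obtain ⟨c, hc⟩ := hpb
  obtain ⟨T, hT⟩ := closure_eq_cyclicSubgroup_or_splitSubgroup hp hq (hΛ a a.2) (hΛ b b.2)
    (congrArg Subtype.val hqa) (congrArg Subtype.val hc.symm) hKa hKb
    (by rw [hht _ (by omega) _ (by omega), hKa, hKb, add_mul, mul_assoc])
    (apply_ne_zero_of_mem_closure_pair (hgen ▸ hne))
  exact ⟨T, hgen ▸ hT⟩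

theorem classification_of_mul_eq_height {p q : ℕ} (hp : p.Prime) (hq : q.Prime) (hN : N = p * q)
    (hK : 0 < K) (hΛ : ∀ x ∈ Λ, ∑ i, x i = 0) (he : ∀ x, (e x : ℕ) * K = height x.1)
    (hne : ∀ i, ∃ x ∈ Λ, x i ≠ 0) :
    (Fintype.card ι = p * q * K ∧ Λ = AddSubgroup.zmultiples fun _ => unitFraction (p * q)) ∨
    (∃ T : Finset ι, T.card = q * K ∧
      ((Fintype.card ι = q * K + (p * q - 1) * K ∧ Λ = cyclicSubgroup T q (p * q)) ∨
        (Fintype.card ι = q * K + p * q * K ∧ Λ = splitSubgroup T q p))) ∨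
    (∃ T : Finset ι, T.card = p * K ∧
      ((Fintype.card ι = p * K + (q * p - 1) * K ∧ Λ = cyclicSubgroup T p (q * p)) ∨
        (Fintype.card ι = p * K + q * p * K ∧ Λ = splitSubgroup T p q))) := by
  obtain ⟨a, ha⟩ | ⟨a, b, hqa, hpb, hab⟩ | ⟨a, b, hpa, hqb, hab⟩ :=
    exists_val_eq_of_card_eq_mul hp hq hN (val_add_le_of_mul_eq_height hΛ hK he)
  · exact Or.inl (hN ▸ eq_zmultiples_unitFraction hΛ
      (by nlinarith [hp.two_le, hq.two_le]) he hne ha)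
  · exact Or.inr (Or.inl (eq_cyclicSubgroup_or_eq_splitSubgroup hΛ hp.two_le hq.two_le hN he hne
      hqa hpb hab))
  · exact Or.inr (Or.inr (eq_cyclicSubgroup_or_eq_splitSubgroup hΛ hq.two_le hp.two_le
      (hN.trans (mul_comm p q)) he hne hpa hqb hab))

end Classification

theorem exists_equiv_fin_mul_eq_height {d N K : ℕ} {v : Fin (d + 1) → Fin d → ℤ}
    (hv : AffineIndependent ℝ fun i => intVec (v i))
    (hδ : IsDeltaPolynomial (latticeHull v)
      (∑ i ∈ Finset.range N, (Polynomial.X : ℤ[X]) ^ (i * K))) :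
    ∃ e : vertexGroup v ≃ Fin N, ∀ x, (e x : ℕ) * K = height x.1 := by
  have := finite_vertexGroup hv
  have := Fintype.ofFinite (vertexGroup v)
  refine exists_equiv_of_sum_X_pow_eq (g := fun i : Fin N => i * K) ?_
  rw [← eq_sum_X_pow_height_of_isDeltaPolynomial hv hδ, Finset.sum_range]

section Duality

variable {d : ℕ} {v w : Fin (d + 1) → Fin d → ℤ}

theorem isUnit_det_homogenization_map (hv : AffineIndependent ℝ fun i => intVec (v i)) :
    IsUnit ((homogenization v).map (Int.cast : ℤ → ℝ)).det := by
  rw [← Int.cast_det, isUnit_iff_ne_zero, Int.cast_ne_zero]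
  exact det_homogenization_ne_zero hv

theorem coe_inv_homogenization_mem_vertexGroup (hv : AffineIndependent ℝ fun i => intVec (v i))
    (k : Fin (d + 1)) :
    (fun i => ((((homogenization v).map (Int.cast : ℤ → ℝ))⁻¹ k i : ℝ) : UnitAddCircle)) ∈
      vertexGroup v := by
  refine mem_vertexGroup_iff_homogenization.2 fun j => ?_
  have hinv := congrFun (congrFun (Matrix.nonsing_inv_mul _ (isUnit_det_homogenization_map hv)) k) j
  simp only [← AddCircle.coe_zsmul, ← QuotientAddGroup.mk_sum]
  refine coe_unitAddCircle_eq_zero_iff.2 ⟨(1 : Matrix (Fin (d + 1)) (Fin (d + 1)) ℤ) k j, ?_⟩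
  calc (((1 : Matrix (Fin (d + 1)) (Fin (d + 1)) ℤ) k j : ℤ) : ℝ)
      = (1 : Matrix (Fin (d + 1)) (Fin (d + 1)) ℝ) k j := by simp [Matrix.one_apply]
    _ = ∑ i, homogenization v i j •
          ((homogenization v).map (Int.cast : ℤ → ℝ))⁻¹ k i := by
        simp only [← hinv, Matrix.mul_apply, Matrix.map_apply, zsmul_eq_mul, mul_comm]

theorem exists_dotProduct_add_eq (hv : AffineIndependent ℝ fun i => intVec (v i))
    {y : Fin (d + 1) → ℤ} (hy : ∀ x ∈ vertexGroup v, ∑ i, y i • x i = 0) :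
    ∃ (c : Fin d → ℤ) (s : ℤ), ∀ i, v i ⬝ᵥ c + s = y i := by
  set H := (homogenization v).map (Int.cast : ℤ → ℝ) with hH
  have hint (k : Fin (d + 1)) : ∃ n : ℤ, (n : ℝ) = ∑ i, y i • H⁻¹ k i := by
    rw [← coe_unitAddCircle_eq_zero_iff, QuotientAddGroup.mk_sum]
    exact hy _ (coe_inv_homogenization_mem_vertexGroup hv k)
  choose c hc using hint
  have hsol : H *ᵥ intVec c = intVec y := by
    have hcy : intVec c = H⁻¹ *ᵥ intVec y := by
      funext k
      simpa [intVec, Matrix.mulVec, dotProduct, mul_comm] using hc k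
    rw [hcy, Matrix.mulVec_mulVec, Matrix.mul_nonsing_inv _ (isUnit_det_homogenization_map hv),
      Matrix.one_mulVec]
  refine ⟨fun k => c k.succ, c 0, fun i => ?_⟩
  have hrow : homogenization v *ᵥ c = y := by
    refine intVec_injective ?_
    rw [← hsol]
    funext i
    simp [hH, intVec, Matrix.mulVec, dotProduct]
  rw [← hrow]
  simp [homogenization, Matrix.mulVec, dotProduct, Fin.sum_univ_succ, add_comm]

theorem exists_vecMul_add_eq (hv : AffineIndependent ℝ fun i => intVec (v i))
    (h : vertexGroup v ≤ vertexGroup w) :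
    ∃ (U : Matrix (Fin d) (Fin d) ℤ) (t : Fin d → ℤ), ∀ i, w i = v i ᵥ* U + t := by
  choose c t hct using fun j => exists_dotProduct_add_eq hv (y := fun i => w i j)
    fun x hx => (h hx).2 j
  exact ⟨(Matrix.of c)ᵀ, t, fun i => funext fun j => (hct j i).symm⟩

theorem eq_one_of_vecMul_add_eq_self (hv : AffineIndependent ℝ fun i => intVec (v i))
    {U : Matrix (Fin d) (Fin d) ℤ} {t : Fin d → ℤ} (h : ∀ i, v i ᵥ* U + t = v i) : U = 1 := by
  ext k j
  have hker : homogenization v *ᵥ Fin.cons (t j) (fun k => U k j - (1 : Matrix _ _ ℤ) k j) = 0 := by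
    funext i
    have hi := congrFun (h i) j
    simp only [Pi.add_apply, Matrix.vecMul, dotProduct] at hi
    suffices t j + (∑ k, v i k * U k j - v i j) = 0 by
      simpa [homogenization, Matrix.mulVec, dotProduct, Fin.sum_univ_succ, mul_sub,
        Finset.sum_sub_distrib, Matrix.one_apply] using this
    linarith
  have := congrFun (Matrix.eq_zero_of_mulVec_eq_zero (det_homogenization_ne_zero hv) hker) k.succ
  simpa [sub_eq_zero] using this

end Duality

section Equivalence

variable {d : ℕ}

theorem intVec_vecMul_add (z t : Fin d → ℤ) (U : Matrix (Fin d) (Fin d) ℤ) :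
    intVec (z ᵥ* U + t) = intVec z ᵥ* U.map (Int.cast : ℤ → ℝ) + intVec t := by
  funext j
  simp [intVec, Matrix.vecMul, dotProduct]

/-- The integral affine map `x ↦ x U + t` of `ℝ^d`. -/
noncomputable def vecMulAddMap (U : Matrix (Fin d) (Fin d) ℤ) (t : Fin d → ℤ) :
    (Fin d → ℝ) →ᵃ[ℝ] (Fin d → ℝ) :=
  (U.map (Int.cast : ℤ → ℝ)).vecMulLinear.toAffineMap + AffineMap.const ℝ _ (intVec t)

theorem vecMulAddMap_intVec (U : Matrix (Fin d) (Fin d) ℤ) (t z : Fin d → ℤ) :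
    vecMulAddMap U t (intVec z) = intVec (z ᵥ* U + t) :=
  (intVec_vecMul_add z t U).symm

theorem vecMulAddMap_injective {U : Matrix (Fin d) (Fin d) ℤ} (hU : IsUnit U.det) (t : Fin d → ℤ) :
    Function.Injective (vecMulAddMap U t) := fun _ _ h =>
  Matrix.vecMul_injective_of_isUnit
    (((Matrix.isUnit_iff_isUnit_det U).2 hU).map (Int.castRingHom ℝ).mapMatrix)
    (add_right_cancel h)

theorem unimodularlyEquivalent_latticeHull {ι : Type*} {v w : ι → Fin d → ℤ}
    {U : Matrix (Fin d) (Fin d) ℤ} {t : Fin d → ℤ} (hU : IsUnit U.det)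
    (h : ∀ i, w i = v i ᵥ* U + t) :
    UnimodularlyEquivalent (latticeHull v) (latticeHull w) := by
  refine ⟨rfl, U, t, Int.isUnit_iff.1 hU, ?_⟩
  simp only [latticeHull, h, ← vecMulAddMap_intVec]
  exact (congrArg _ (Set.range_comp _ _)).trans ((vecMulAddMap U t).image_convexHull _).symm

theorem unimodularlyEquivalent_of_vertexGroup_eq {v w : Fin (d + 1) → Fin d → ℤ}
    (hv : AffineIndependent ℝ fun i => intVec (v i)) (h : vertexGroup v = vertexGroup w) :
    UnimodularlyEquivalent (latticeHull v) (latticeHull w) := by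
  have : Finite (vertexGroup w) := h ▸ finite_vertexGroup hv
  obtain ⟨U, t, hU⟩ := exists_vecMul_add_eq hv h.le
  obtain ⟨U', t', hU'⟩ := exists_vecMul_add_eq
    (affineIndependent_of_finite_vertexGroup (v := w)) h.ge
  have hmul : U * U' = 1 := eq_one_of_vecMul_add_eq_self hv (t := t ᵥ* U' + t') fun i => by
    rw [← Matrix.vecMul_vecMul, ← add_assoc, ← Matrix.add_vecMul, ← hU, ← hU']
  exact unimodularlyEquivalent_latticeHull
    (IsUnit.of_mul_eq_one U'.det (by rw [← Matrix.det_mul, hmul, Matrix.det_one])) hU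

theorem mem_vertexGroup_comp_iff {ι : Type*} [Fintype ι] {w : ι → Fin d → ℤ} {σ : Equiv.Perm ι}
    {x : ι → UnitAddCircle} : x ∈ vertexGroup (w ∘ σ) ↔ x ∘ σ.symm ∈ vertexGroup w := by
  simp only [mem_vertexGroup, Function.comp_apply]
  rw [Equiv.sum_comp σ.symm x]
  refine and_congr_right' (forall_congr' fun j => ?_)
  rw [← Equiv.sum_comp σ fun i => w i j • x (σ.symm i)]
  simp only [Equiv.symm_apply_apply]

theorem latticeHull_comp_perm {ι : Type*} (w : ι → Fin d → ℤ) (σ : Equiv.Perm ι) :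
    latticeHull (w ∘ σ) = latticeHull w :=
  congrArg (convexHull ℝ) (σ.surjective.range_comp fun i => intVec (w i))

end Equivalence

section Pyramid

variable {n : ℕ}

theorem exists_basis_repr_last {R M : Type*} [CommRing R] [IsDomain R] [IsPrincipalIdealRing R]
    [AddCommGroup M] [Module R M] (b₀ : Module.Basis (Fin (n + 1)) R M) (ℓ : M →ₗ[R] R) {y : M}
    (hy : ℓ y = 1) :
    ∃ b : Module.Basis (Fin (n + 1)) R M,
      b (Fin.last n) = y ∧ ∀ z, b.repr z (Fin.last n) = ℓ z := by
  obtain ⟨m, ⟨b'⟩⟩ := Submodule.nonempty_basis_of_pid b₀ (LinearMap.ker ℓ)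
  let b := Module.Basis.mkFinSnoc b' y
    (fun c x hx h => by simpa [hy, LinearMap.mem_ker.1 hx] using congrArg ℓ h)
    (fun z => ⟨-ℓ z, by simp [hy]⟩)
  obtain rfl : m = n := by
    simpa using (Module.finrank_eq_card_basis b).symm.trans (Module.finrank_eq_card_basis b₀)
  have hlast : b (Fin.last m) = y := by simp [b]
  have hker (i : Fin m) : ℓ (b i.castSucc) = 0 := by simp [b]
  refine ⟨b, hlast, fun z => ?_⟩
  conv_rhs => rw [← b.sum_repr z, Fin.sum_univ_castSucc, hlast]
  simp [hker, hy]

theorem exists_isUnit_det_vecMul_eq_repr (B : Module.Basis (Fin n) ℤ (Fin n → ℤ)) :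
    ∃ U : Matrix (Fin n) (Fin n) ℤ, IsUnit U.det ∧ ∀ z, z ᵥ* U = B.repr z := by
  refine ⟨(B.toMatrix (Pi.basisFun ℤ (Fin n)))ᵀ, ?_, fun z => ?_⟩
  · rw [Matrix.det_transpose]
    refine IsUnit.of_mul_eq_one ((Pi.basisFun ℤ (Fin n)).toMatrix B).det ?_
    rw [← Matrix.det_mul, Module.Basis.toMatrix_mul_toMatrix_flip, Matrix.det_one]
  · rw [Matrix.vecMul_transpose]
    exact (Pi.basisFun ℤ (Fin n)).toMatrix_mulVec_repr B z

/-- The embedding of `ℝ^n` into `ℝ^(n+1)` as the hyperplane of vanishing last coordinate. -/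
def snocZero (n : ℕ) : (Fin n → ℝ) →ₗ[ℝ] (Fin (n + 1) → ℝ) where
  toFun x := Fin.snoc x 0
  map_add' x y := by
    funext i
    refine Fin.lastCases ?_ (fun i => ?_) i <;> simp
  map_smul' c x := by
    funext i
    refine Fin.lastCases ?_ (fun i => ?_) i <;> simp

theorem intVec_snoc_zero (z : Fin n → ℤ) :
    intVec (Fin.snoc z 0 : Fin (n + 1) → ℤ) = snocZero n (intVec z) := by
  funext k
  refine Fin.lastCases ?_ (fun k => ?_) k <;> simp [intVec, snocZero]

theorem intVec_single (k : Fin n) : intVec (Pi.single k 1) = Pi.single k 1 := by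
  funext i
  simp [intVec, Pi.single_apply]

theorem latticePyramid_latticeHull {m : ℕ} (w : Fin m → Fin n → ℤ)
    {u : Fin (m + 1) → Fin (n + 1) → ℤ} {i : Fin (m + 1)} (hi : u i = Pi.single (Fin.last n) 1)
    (hw : ∀ r, u (i.succAbove r) = Fin.snoc (w r) 0) :
    latticePyramid (latticeHull w) = latticeHull u := by
  have hu : Set.range (fun r => intVec (u r)) =
      snocZero n '' Set.range (fun r => intVec (w r)) ∪ {Pi.single (Fin.last n) 1} := by
    rw [← Set.range_comp, Set.union_singleton, ← intVec_single, ← hi]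
    ext x
    simp [Fin.exists_iff_succAbove i, hw, intVec_snoc_zero, eq_comm]
  simp only [latticeHull]
  rw [hu, ← convexHull_convexHull_union_left, ← LinearMap.image_convexHull]
  rfl

theorem isLatticePyramid_of_forall_apply_eq_zero {v : Fin (n + 2) → Fin (n + 1) → ℤ}
    (hv : AffineIndependent ℝ fun i => intVec (v i)) {i : Fin (n + 2)}
    (hi : ∀ x ∈ vertexGroup v, x i = 0) : IsLatticePyramid (latticeHull v) := by
  -- The `i`-th barycentric coordinate is an integral affine function `ℓ + s`.
  obtain ⟨c, s, hcs⟩ := exists_dotProduct_add_eq hv (y := Pi.single i 1) fun x hx => by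
    simp [Pi.single_apply, hi x hx]
  have hℓ (r : Fin (n + 2)) : c ⬝ᵥ (v r - v (i.succAbove 0)) = (Pi.single i 1 : _ → ℤ) r := by
    have h₀ : (Pi.single i 1 : _ → ℤ) (i.succAbove 0) = 0 :=
      Pi.single_eq_of_ne (Fin.succAbove_ne i 0) 1
    rw [dotProduct_comm, sub_dotProduct]
    linarith [hcs r, hcs (i.succAbove 0)]
  obtain ⟨b, hlast, hrepr⟩ := exists_basis_repr_last (Pi.basisFun ℤ (Fin (n + 1)))
    (dotProductBilin ℤ ℤ c) (y := v i - v (i.succAbove 0)) ((hℓ i).trans (Pi.single_eq_same i 1))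
  obtain ⟨U, hU, hUrepr⟩ := exists_isUnit_det_vecMul_eq_repr b
  -- In the new coordinates `u`, the vertex `i` is `e_{n+1}` and the others lie in `ℤ^n × {0}`.
  let u (r : Fin (n + 2)) : Fin (n + 1) → ℤ := v r ᵥ* U + -(v (i.succAbove 0) ᵥ* U)
  have hu (r : Fin (n + 2)) : u r = b.repr (v r - v (i.succAbove 0)) := by
    rw [← hUrepr, Matrix.sub_vecMul, sub_eq_add_neg]
  have hui : u i = Pi.single (Fin.last n) 1 := by
    rw [hu, ← hlast, b.repr_self, Finsupp.single_eq_pi_single]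
  let w (r : Fin (n + 1)) : Fin n → ℤ := Fin.init (u (i.succAbove r))
  have huw (r : Fin (n + 1)) : u (i.succAbove r) = Fin.snoc (w r) 0 := by
    have h₀ : u (i.succAbove r) (Fin.last n) = 0 := by
      rw [hu, hrepr]
      exact (hℓ _).trans (Pi.single_eq_of_ne (Fin.succAbove_ne i r) 1)
    rw [← h₀, Fin.snoc_init_self]
  refine ⟨n, latticeHull w, ⟨w, ?_, rfl⟩, ?_⟩
  · have huaff : AffineIndependent ℝ fun r => intVec (u (i.succAbove r)) := by
      simp only [u, ← vecMulAddMap_intVec]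
      exact (hv.comp_embedding i.succAboveEmb).map' _ (vecMulAddMap_injective hU _)
    simp only [huw, intVec_snoc_zero] at huaff
    exact huaff.of_comp (snocZero n).toAffineMap
  · rw [latticePyramid_latticeHull w hui huw]
    exact unimodularlyEquivalent_latticeHull hU fun _ => rfl

end Pyramid

section Permutation

variable {ι : Type*} {T P : Finset ι} {x : ι → UnitAddCircle}

theorem exists_perm_mem_iff_mem [Finite ι] (h : T.card = P.card) :
    ∃ σ : Equiv.Perm ι, ∀ i, σ i ∈ T ↔ i ∈ P := by
  classical
  let σ₀ : {i // i ∈ P} ≃ {i // i ∈ T} := Finset.equivOfCardEq h.symm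
  refine ⟨σ₀.extendSubtype, fun i => ⟨fun hi => ?_, σ₀.extendSubtype_mem i⟩⟩
  by_contra hP
  exact σ₀.extendSubtype_not_mem i hP hi

variable [DecidableEq ι]

theorem comp_symm_mem_cyclicSubgroup_iff {r n : ℕ} (hn : 0 < n) {σ : Equiv.Perm ι}
    (hσ : ∀ i, σ i ∈ T ↔ i ∈ P) :
    x ∘ σ.symm ∈ cyclicSubgroup T r n ↔ x ∈ cyclicSubgroup P r n := by
  rw [mem_cyclicSubgroup hn, mem_cyclicSubgroup hn]
  refine exists_congr fun t => and_congr_right' ?_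
  rw [← Equiv.forall_congr_right σ]
  simp [hσ]

theorem comp_symm_mem_splitSubgroup_iff {m n : ℕ} (hm : 0 < m) (hn : 0 < n) {σ : Equiv.Perm ι}
    (hσ : ∀ i, σ i ∈ T ↔ i ∈ P) :
    x ∘ σ.symm ∈ splitSubgroup T m n ↔ x ∈ splitSubgroup P m n := by
  rw [mem_splitSubgroup hm hn, mem_splitSubgroup hm hn]
  refine exists_congr fun s => exists_congr fun t => and_congr_right' (and_congr_right' ?_)
  rw [← Equiv.forall_congr_right σ]
  simp [hσ]

end Permutation

section OriginRows

variable {d : ℕ}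

/-- The vertices of `hullOriginRows M`: the origin followed by the rows of `M`. -/
def originRows (M : Matrix (Fin d) (Fin d) ℤ) : Fin (d + 1) → Fin d → ℤ := Fin.cons 0 fun i => M i

theorem hullOriginRows_eq_latticeHull (M : Matrix (Fin d) (Fin d) ℤ) :
    hullOriginRows M = latticeHull (originRows M) := by
  have h₀ : intVec (0 : Fin d → ℤ) = 0 := by
    funext i
    simp [intVec]
  refine congrArg (convexHull ℝ) ?_
  ext x
  simp [originRows, Fin.exists_fin_succ, h₀, eq_comm]

theorem mem_vertexGroup_originRows {M : Matrix (Fin d) (Fin d) ℤ}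
    {x : Fin (d + 1) → UnitAddCircle} :
    x ∈ vertexGroup (originRows M) ↔ ∑ i, x i = 0 ∧ ∀ j, ∑ i, M i j • x (Fin.succ i) = 0 := by
  simp [mem_vertexGroup, originRows, Fin.sum_univ_succ]

theorem sum_zsmul_eq_add_sum {ι G : Type*} [Fintype ι] [DecidableEq ι] [AddCommGroup G]
    {S : Finset ι} {a : ι → ℤ} {j : ι} (h : ∀ i ∉ S, a i = if i = j then 1 else 0) (x : ι → G) :
    ∑ i, a i • x i = x j + ∑ i ∈ S, (a i - if i = j then 1 else 0) • x i := by
  rw [Finset.sum_subset S.subset_univ fun i _ hi => by rw [h i hi, sub_self, zero_smul]]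
  simp [sub_smul]

theorem eq_of_sum_eq_of_succ_eq {G : Type*} [AddCommGroup G] {x y : Fin (d + 1) → G}
    (hsum : ∑ i, x i = ∑ i, y i) (hsucc : ∀ j : Fin d, x j.succ = y j.succ) : x = y := by
  rw [Fin.sum_univ_succ, Fin.sum_univ_succ, Finset.sum_congr rfl fun j _ => hsucc j] at hsum
  exact funext (Fin.cases (add_right_cancel hsum) hsucc)

theorem mem_vertexGroup_vertexMatrixA {A : List ℤ} {e : Fin A.length} (he : e + 1 = A.length)
    {x : Fin (A.length + 1) → UnitAddCircle} :
    x ∈ vertexGroup (originRows (vertexMatrixA A)) ↔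
      ∑ i, x i = 0 ∧ A[e] • x e.succ = 0 ∧ ∀ j ≠ e, x j.succ = A[j] • x e.succ := by
  have hcol (j : Fin A.length) : ∑ i, vertexMatrixA A i j • x i.succ =
      if j = e then A[e] • x e.succ else x j.succ + (A[e] - A[j]) • x e.succ := by
    rw [sum_zsmul_eq_add_sum (S := {e}) (j := j) fun i hi => by
      simp [vertexMatrixA, show (i : ℕ) + 1 ≠ A.length by grind]]
    split_ifs with hj
    · subst hj
      simp [vertexMatrixA, he, sub_smul]
    · simp [vertexMatrixA, he, hj, Ne.symm hj]
  simp only [mem_vertexGroup_originRows, hcol]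
  refine and_congr_right' ⟨fun h => ?_, fun ⟨he₀, h⟩ j => ?_⟩
  · have he₀ : A[e] • x e.succ = 0 := by simpa using h e
    refine ⟨he₀, fun j hj => ?_⟩
    have hj' := h j
    rwa [if_neg hj, sub_smul, he₀, zero_sub, ← sub_eq_add_neg, sub_eq_zero] at hj'
  · split_ifs with hj
    · exact he₀
    · rw [h j hj, sub_smul, he₀, zero_sub, add_neg_cancel]

theorem sum_vertexMatrixBC_zsmul {B C : List ℤ} {e' e : Fin C.length} (hlt : e' < e)
    (he' : e' + 1 = B.length) (he : e + 1 = C.length) (hC : ∀ j ≤ e', C[j] = C[e])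
    (x : Fin C.length → UnitAddCircle) (j : Fin C.length) :
    ∑ i, vertexMatrixBC B C i j • x i =
      if j < e' then x j + (B.getD e' 0 - B.getD j 0) • x e'
      else if j = e' then B.getD e' 0 • x e'
      else if j < e then x j + (C[e] - C[j]) • x e
      else C[e] • x e := by
  have hBC : B.length ≠ C.length := by omega
  rw [sum_zsmul_eq_add_sum (S := {e', e}) (j := j) fun i hi => by
    simp [vertexMatrixBC, show (i : ℕ) + 1 ≠ C.length by grind,
      show (i : ℕ) + 1 ≠ B.length by grind], Finset.sum_pair hlt.ne]
  have hj : j < e' ∨ j = e' ∨ (e' < j ∧ j < e) ∨ j = e := by grind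
  rcases hj with hj | rfl | ⟨hj, hje⟩ | rfl
  · have hCj : C[(j : ℕ)] = C[(e : ℕ)] := hC j hj.le
    simp [vertexMatrixBC, he, he', hBC, hj, hj.ne, hj.ne', (hj.trans hlt).ne,
      (hj.trans hlt).ne', hCj]
  · have hCj : C[(j : ℕ)] = C[(e : ℕ)] := hC j le_rfl
    simp [vertexMatrixBC, he, he', hBC, hlt.ne, hlt.ne', hCj, sub_smul]
  · simp [vertexMatrixBC, he, he', hBC, hj.not_gt, hj.ne, hj.ne', hje, hje.ne, hje.ne']
  · simp [vertexMatrixBC, he, he', hBC, hlt.not_gt, hlt.ne, hlt.ne', sub_smul]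

theorem mem_vertexGroup_vertexMatrixBC {B C : List ℤ} {e' e : Fin C.length} (hlt : e' < e)
    (he' : e' + 1 = B.length) (he : e + 1 = C.length) (hC : ∀ j ≤ e', C[j] = C[e])
    {x : Fin (C.length + 1) → UnitAddCircle} :
    x ∈ vertexGroup (originRows (vertexMatrixBC B C)) ↔
      ∑ i, x i = 0 ∧ B.getD e' 0 • x e'.succ = 0 ∧ C[e] • x e.succ = 0 ∧
        (∀ j < e', x j.succ = B.getD j 0 • x e'.succ) ∧
          ∀ j, e' < j → j < e → x j.succ = C[j] • x e.succ := by
  simp only [mem_vertexGroup_originRows,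
    sum_vertexMatrixBC_zsmul hlt he' he hC fun i => x i.succ]
  refine and_congr_right' ⟨fun h => ?_, fun ⟨hb, hc, hlow, hmid⟩ j => ?_⟩
  · have hb : B.getD e' 0 • x e'.succ = 0 := by simpa using h e'
    have hc : C[e] • x e.succ = 0 := by simpa [hlt.not_gt, hlt.ne'] using h e
    refine ⟨hb, hc, fun j hj => ?_, fun j hj hje => ?_⟩
    · have hj' := h j
      rwa [if_pos hj, sub_smul, hb, zero_sub, ← sub_eq_add_neg, sub_eq_zero] at hj'
    · have hj' := h j
      rwa [if_neg hj.not_gt, if_neg hj.ne', if_pos hje, sub_smul, hc, zero_sub, ← sub_eq_add_neg,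
        sub_eq_zero] at hj'
  · split_ifs with hj hj' hje
    · rw [hlow j hj, sub_smul, hb, zero_sub, add_neg_cancel]
    · exact hb
    · rw [hmid j (lt_of_le_of_ne (not_lt.1 hj) (Ne.symm hj')) hje, sub_smul, hc, zero_sub,
        add_neg_cancel]
    · exact hc

end OriginRows

section NormalForms

variable {d : ℕ} {v : Fin (d + 1) → Fin d → ℤ} {T P : Finset (Fin (d + 1))}

theorem exists_perm_vertexGroup_comp_eq_cyclicSubgroup {r n : ℕ} (hn : 0 < n)
    (hT : T.card = P.card) (hΛ : vertexGroup v = cyclicSubgroup T r n) :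
    ∃ σ : Equiv.Perm (Fin (d + 1)), vertexGroup (v ∘ σ) = cyclicSubgroup P r n := by
  obtain ⟨σ, hσ⟩ := exists_perm_mem_iff_mem hT
  refine ⟨σ, AddSubgroup.ext fun x => ?_⟩
  rw [mem_vertexGroup_comp_iff, hΛ, comp_symm_mem_cyclicSubgroup_iff hn hσ]

theorem exists_perm_vertexGroup_comp_eq_splitSubgroup {m n : ℕ} (hm : 0 < m) (hn : 0 < n)
    (hT : T.card = P.card) (hΛ : vertexGroup v = splitSubgroup T m n) :
    ∃ σ : Equiv.Perm (Fin (d + 1)), vertexGroup (v ∘ σ) = splitSubgroup P m n := by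
  obtain ⟨σ, hσ⟩ := exists_perm_mem_iff_mem hT
  refine ⟨σ, AddSubgroup.ext fun x => ?_⟩
  rw [mem_vertexGroup_comp_iff, hΛ, comp_symm_mem_splitSubgroup_iff hm hn hσ]

theorem vertexGroup_vertexMatrixA {A : List ℤ} {e : Fin A.length} {r n : ℕ}
    {P : Finset (Fin (A.length + 1))} (hn : 0 < n) (he : e + 1 = A.length) (hAe : A[e] = n)
    (heP : e.succ ∈ P) (hA : ∀ j ≠ e, A[j] = if j.succ ∈ P then 1 else (r : ℤ))
    (hsum : ∀ x ∈ cyclicSubgroup P r n, ∑ i, x i = 0) :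
    vertexGroup (originRows (vertexMatrixA A)) = cyclicSubgroup P r n := by
  refine AddSubgroup.ext fun x => ?_
  have hcoeff (t : UnitAddCircle) (j : Fin A.length) (hj : j ≠ e) :
      A[j] • t = if j.succ ∈ P then t else r • t := by
    rw [hA j hj]
    split_ifs <;> simp
  rw [mem_vertexGroup_vertexMatrixA he, hAe, natCast_zsmul]
  refine ⟨fun ⟨hx, hxe, hxj⟩ => ?_, fun hx => ?_⟩
  · let y (i : Fin (A.length + 1)) := if i ∈ P then x e.succ else r • x e.succ
    have hy : y ∈ cyclicSubgroup P r n := (mem_cyclicSubgroup hn).2 ⟨_, hxe, fun _ => rfl⟩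
    suffices x = y from this ▸ hy
    refine eq_of_sum_eq_of_succ_eq (hx.trans (hsum y hy).symm) fun j => ?_
    obtain rfl | hj := eq_or_ne j e
    · exact (if_pos heP).symm
    · rw [hxj j hj, hcoeff _ j hj]
  · obtain ⟨t, ht, hxt⟩ := (mem_cyclicSubgroup hn).1 hx
    have hxe : x e.succ = t := by rw [hxt, if_pos heP]
    exact ⟨hsum x hx, hxe ▸ ht, fun j hj => by rw [hxe, hcoeff t j hj, hxt]⟩

theorem vertexGroup_vertexMatrixBC {B C : List ℤ} {e' e : Fin C.length} {m n : ℕ}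
    {P : Finset (Fin (C.length + 1))} (hm : 0 < m) (hn : 0 < n) (hlt : e' < e)
    (he' : e' + 1 = B.length) (he : e + 1 = C.length) (hBe : B.getD e' 0 = m)
    (hB : ∀ j < e', B.getD j 0 = 1)
    (hC : ∀ j, C[j] = if j ≤ e' ∨ j = e then (n : ℤ) else 1) (hP : ∀ j, j.succ ∈ P ↔ j ≤ e')
    (hsum : ∀ x ∈ splitSubgroup P m n, ∑ i, x i = 0) :
    vertexGroup (originRows (vertexMatrixBC B C)) = splitSubgroup P m n := by
  refine AddSubgroup.ext fun x => ?_
  have hCe : C[e] = n := (hC e).trans (if_pos (Or.inr rfl))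
  rw [mem_vertexGroup_vertexMatrixBC hlt he' he fun j hj => by rw [hC, if_pos (Or.inl hj), hCe],
    hBe, hCe, natCast_zsmul, natCast_zsmul]
  have hP' (s t : UnitAddCircle) (j : Fin C.length) :
      (if j.succ ∈ P then s else t) = if j ≤ e' then s else t := by simp only [hP]
  refine ⟨fun ⟨hx, hxe', hxe, hlow, hmid⟩ => ?_, fun hx => ?_⟩
  · let y (i : Fin (C.length + 1)) := if i ∈ P then x e'.succ else x e.succ
    have hy : y ∈ splitSubgroup P m n :=
      (mem_splitSubgroup hm hn).2 ⟨_, _, hxe', hxe, fun _ => rfl⟩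
    suffices x = y from this ▸ hy
    refine eq_of_sum_eq_of_succ_eq (hx.trans (hsum y hy).symm) fun j => ?_
    simp only [y, hP']
    obtain hj | rfl | hj := lt_trichotomy j e'
    · rw [if_pos hj.le, hlow j hj, hB j hj, one_zsmul]
    · rw [if_pos le_rfl]
    · rw [if_neg hj.not_ge]
      obtain rfl | hje := eq_or_ne j e
      · rfl
      · rw [hmid j hj (by omega), hC, if_neg (by simp [hj.not_ge, hje]), one_zsmul]
  · obtain ⟨s, t, hs, ht, hxst⟩ := (mem_splitSubgroup hm hn).1 hx
    have hx' (j : Fin C.length) : x j.succ = if j ≤ e' then s else t := (hxst _).trans (hP' s t j)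
    refine ⟨hsum x hx, ?_, ?_, fun j hj => ?_, fun j hj hje => ?_⟩
    · rwa [hx', if_pos le_rfl]
    · rwa [hx', if_neg hlt.not_ge]
    · rw [hx', hx', if_pos hj.le, if_pos le_rfl, hB j hj, one_zsmul]
    · rw [hx', hx', if_neg hj.not_ge, if_neg hlt.not_ge, hC, if_neg (by grind), one_zsmul]

theorem unimodularlyEquivalent_simplexA (hv : AffineIndependent ℝ fun i => intVec (v i))
    {r n a b : ℕ} (hn : 0 < n) (ha : 0 < a) (hb : 0 < b) (hd : d + 1 = a + b) (hT : T.card = a)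
    (hΛ : vertexGroup v = cyclicSubgroup T r n) :
    UnimodularlyEquivalent (latticeHull v)
      (simplexA (List.replicate (a - 1) 1 ++ List.replicate (b - 1) (r : ℤ) ++ [(n : ℤ)])) := by
  generalize hA : List.replicate (a - 1) 1 ++ List.replicate (b - 1) (r : ℤ) ++ [(n : ℤ)] = A
  obtain rfl : d = A.length := by
    simp only [← hA, List.length_append, List.length_replicate, List.length_singleton]
    omega
  let P : Finset (Fin (A.length + 1)) :=
    insert (Fin.last _) (Finset.Ioo 0 ⟨a, by omega⟩)
  have hP : P.card = a := by
    rw [Finset.card_insert_of_notMem (by simp [Fin.le_last]), Fin.card_Ioo, Fin.val_zero, tsub_zero,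
      Nat.sub_add_cancel ha]
  have hmem (j : Fin A.length) : j.succ ∈ P ↔ j + 1 = A.length ∨ j + 1 < a := by
    simp [P, Fin.ext_iff, Fin.lt_def]
  obtain ⟨σ, hσ⟩ := exists_perm_vertexGroup_comp_eq_cyclicSubgroup hn (hT.trans hP.symm) hΛ
  have hA' : vertexGroup (originRows (vertexMatrixA A)) = cyclicSubgroup P r n := by
    refine vertexGroup_vertexMatrixA (e := ⟨a + b - 2, by omega⟩) hn (by grind) (by grind)
      (by grind) ?_ fun x hx => (hσ ▸ hx : x ∈ vertexGroup (v ∘ σ)).1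
    simp only [hmem]
    grind
  rw [← latticeHull_comp_perm v σ, simplexA, hullOriginRows_eq_latticeHull]
  exact unimodularlyEquivalent_of_vertexGroup_eq (hv.comp_embedding σ.toEmbedding)
    (hσ.trans hA'.symm)

theorem unimodularlyEquivalent_simplexA_of_zmultiples
    (hv : AffineIndependent ℝ fun i => intVec (v i)) {n m : ℕ} (hn : 0 < n) (hm : 2 ≤ m)
    (hd : d + 1 = m) (hΛ : vertexGroup v = AddSubgroup.zmultiples fun _ => unitFraction n) :
    UnimodularlyEquivalent (latticeHull v)
      (simplexA (List.replicate (m - 2) 1 ++ [(n : ℤ)])) := by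
  have hT : (Finset.univ.erase (0 : Fin (d + 1))).card = m - 1 := by
    rw [Finset.card_erase_of_mem (Finset.mem_univ _), Finset.card_univ, Fintype.card_fin, hd]
  have hA : List.replicate (m - 1 - 1) 1 ++ List.replicate (1 - 1) ((1 : ℕ) : ℤ) ++ [(n : ℤ)] =
      List.replicate (m - 2) 1 ++ [(n : ℤ)] := by
    simp [Nat.sub_sub]
  rw [← hA]
  exact unimodularlyEquivalent_simplexA hv hn (by omega) one_pos (by omega) hT
    (hΛ.trans (cyclicSubgroup_one _ n).symm)

theorem unimodularlyEquivalent_simplexBC (hv : AffineIndependent ℝ fun i => intVec (v i))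
    {m n a b : ℕ} (hm : 0 < m) (hn : 0 < n) (ha : 0 < a) (hb : 2 ≤ b) (hd : d + 1 = a + b)
    (hT : T.card = a) (hΛ : vertexGroup v = splitSubgroup T m n) :
    UnimodularlyEquivalent (latticeHull v) (simplexBC (List.replicate (a - 1) 1 ++ [(m : ℤ)])
      (List.replicate a (n : ℤ) ++ List.replicate (b - 2) 1 ++ [(n : ℤ)])) := by
  generalize hB : List.replicate (a - 1) 1 ++ [(m : ℤ)] = B
  generalize hC : List.replicate a (n : ℤ) ++ List.replicate (b - 2) 1 ++ [(n : ℤ)] = C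
  obtain rfl : d = C.length := by
    simp only [← hC, List.length_append, List.length_replicate, List.length_singleton]
    omega
  let P : Finset (Fin (C.length + 1)) := Finset.Ioc 0 ⟨a, by omega⟩
  have hP : P.card = a := by simp [P]
  obtain ⟨σ, hσ⟩ := exists_perm_vertexGroup_comp_eq_splitSubgroup hm hn (hT.trans hP.symm) hΛ
  have hBC : vertexGroup (originRows (vertexMatrixBC B C)) = splitSubgroup P m n := by
    refine vertexGroup_vertexMatrixBC (e' := ⟨a - 1, by omega⟩) (e := ⟨a + b - 2, by omega⟩) hm hn
      (by grind) (by grind) (by grind) (by grind) (by grind) (by grind) ?_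
      fun x hx => (hσ ▸ hx : x ∈ vertexGroup (v ∘ σ)).1
    intro j
    simp only [P, Finset.mem_Ioc, Fin.succ_pos, true_and, Fin.le_def, Fin.val_succ]
    omega
  rw [← latticeHull_comp_perm v σ, simplexBC, hullOriginRows_eq_latticeHull]
  exact unimodularlyEquivalent_of_vertexGroup_eq (hv.comp_embedding σ.toEmbedding)
    (hσ.trans hBC.symm)

end NormalForms

section Classification

variable {d : ℕ} {v : Fin (d + 1) → Fin d → ℤ}

theorem unimodularlyEquivalent_simplexA_or_simplexBC
    (hv : AffineIndependent ℝ fun i => intVec (v i)) {p q K : ℕ} (hp : 2 ≤ p) (hq : 2 ≤ q)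
    (hK : 0 < K) {T : Finset (Fin (d + 1))} (hT : T.card = q * K)
    (h : (Fintype.card (Fin (d + 1)) = q * K + (p * q - 1) * K ∧
        vertexGroup v = cyclicSubgroup T q (p * q)) ∨
      (Fintype.card (Fin (d + 1)) = q * K + p * q * K ∧ vertexGroup v = splitSubgroup T q p)) :
    UnimodularlyEquivalent (latticeHull v)
      (simplexA (List.replicate (q * K - 1) 1 ++
        List.replicate ((p * q - 1) * K - 1) (q : ℤ) ++ [(p : ℤ) * q])) ∨
    UnimodularlyEquivalent (latticeHull v)
      (simplexBC (List.replicate (q * K - 1) 1 ++ [(q : ℤ)])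
        (List.replicate (q * K) (p : ℤ) ++ List.replicate (p * q * K - 2) 1 ++ [(p : ℤ)])) := by
  have hpq : 4 ≤ p * q := Nat.mul_le_mul hp hq
  have hqK : 0 < q * K := by positivity
  rw [Fintype.card_fin] at h
  rcases h with ⟨hd, hΛ⟩ | ⟨hd, hΛ⟩
  · rw [← Nat.cast_mul]
    exact Or.inl (unimodularlyEquivalent_simplexA hv (by omega) hqK
      (Nat.mul_pos (by omega) hK) hd hT hΛ)
  · exact Or.inr (unimodularlyEquivalent_simplexBC hv (by omega) (by omega) hqK
      (by nlinarith) hd hT hΛ)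

theorem exists_mem_vertexGroup_apply_ne_zero [Nontrivial (vertexGroup v)]
    (hv : AffineIndependent ℝ fun i => intVec (v i)) (hpyr : ¬ IsLatticePyramid (latticeHull v))
    (i : Fin (d + 1)) : ∃ x ∈ vertexGroup v, x i ≠ 0 := by
  obtain _ | n := d
  · obtain ⟨x, hx⟩ := exists_ne (0 : vertexGroup v)
    refine absurd (Subtype.ext (funext fun j => ?_)) hx
    simpa [Fin.fin_one_eq_zero j] using (mem_vertexGroup.1 x.2).1
  · by_contra! hi
    exact hpyr (isLatticePyramid_of_forall_apply_eq_zero hv hi)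

end Classification

theorem corollary3p7_general (p q k d : ℕ) (hp : p.Prime) (hq : q.Prime)
    (Δ : Set (Fin d → ℝ)) (hΔ : IsLatticeSimplex Δ)
    (hδ : IsDeltaPolynomial Δ (∑ i ∈ Finset.range (p * q), (Polynomial.X : ℤ[X]) ^ (i * (k + 1))))
    (hpyr : ¬ IsLatticePyramid Δ) :
    let A₁ : List ℤ := List.replicate (p * q * (k + 1) - 2) 1 ++ [(p : ℤ) * q]
    let B₁ : List ℤ := List.replicate (p * (k + 1) - 1) 1 ++ [(p : ℤ)]
    let C₁ : List ℤ :=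
      List.replicate (p * (k + 1)) (q : ℤ) ++ List.replicate (p * q * (k + 1) - 2) 1 ++ [(q : ℤ)]
    let B₂ : List ℤ := List.replicate (q * (k + 1) - 1) 1 ++ [(q : ℤ)]
    let C₂ : List ℤ :=
      List.replicate (q * (k + 1)) (p : ℤ) ++ List.replicate (p * q * (k + 1) - 2) 1 ++ [(p : ℤ)]
    let A₂ : List ℤ :=
      List.replicate (p * (k + 1) - 1) 1 ++
        List.replicate ((p * q - 1) * (k + 1) - 1) (p : ℤ) ++ [(p : ℤ) * q]
    let A₃ : List ℤ :=
      List.replicate (q * (k + 1) - 1) 1 ++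
        List.replicate ((p * q - 1) * (k + 1) - 1) (q : ℤ) ++ [(p : ℤ) * q]
    UnimodularlyEquivalent Δ (simplexA A₁) ∨
    UnimodularlyEquivalent Δ (simplexA A₂) ∨
    UnimodularlyEquivalent Δ (simplexA A₃) ∨
    UnimodularlyEquivalent Δ (simplexBC B₁ C₁) ∨
    UnimodularlyEquivalent Δ (simplexBC B₂ C₂) := by
  intro A₁ B₁ C₁ B₂ C₂ A₂ A₃
  obtain ⟨v, hv, rfl⟩ := hΔ
  have hpq : 4 ≤ p * q := Nat.mul_le_mul hp.two_le hq.two_le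
  have hK := k.succ_pos
  obtain ⟨e, he⟩ := exists_equiv_fin_mul_eq_height hv hδ
  have : Nontrivial (Fin (p * q)) := Fin.nontrivial_iff_two_le.2 (by omega)
  have : Nontrivial (vertexGroup v) := e.nontrivial
  obtain ⟨hd, hΛ⟩ | ⟨T, hT, h⟩ | ⟨T, hT, h⟩ := classification_of_mul_eq_height hp hq rfl hK
    (fun _ hx => (mem_vertexGroup.1 hx).1) he (exists_mem_vertexGroup_apply_ne_zero hv hpyr)
  · left
    have h := unimodularlyEquivalent_simplexA_of_zmultiples hv (by omega) (by nlinarith)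
      ((Fintype.card_fin _).symm.trans hd) hΛ
    rwa [Nat.cast_mul] at h
  · have h := unimodularlyEquivalent_simplexA_or_simplexBC hv hp.two_le hq.two_le hK hT h
    tauto
  · have h := unimodularlyEquivalent_simplexA_or_simplexBC hv hq.two_le hp.two_le hK hT h
    rw [mul_comm q p, mul_comm (q : ℤ) p] at h
    tauto

theorem corollary3p7 (p q k d : ℕ) (hp : p.Prime) (hq : q.Prime) (hpq : p ≠ q)
    (Δ : Set (Fin d → ℝ)) (hΔ : IsLatticeSimplex Δ)
    (hδ : IsDeltaPolynomial Δ (∑ i ∈ Finset.range (p * q), (Polynomial.X : ℤ[X]) ^ (i * (k + 1))))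
    (hpyr : ¬ IsLatticePyramid Δ) :
    let A₁ : List ℤ := List.replicate (p * q * (k + 1) - 2) 1 ++ [(p : ℤ) * q]
    let B₁ : List ℤ := List.replicate (p * (k + 1) - 1) 1 ++ [(p : ℤ)]
    let C₁ : List ℤ :=
      List.replicate (p * (k + 1)) (q : ℤ) ++ List.replicate (p * q * (k + 1) - 2) 1 ++ [(q : ℤ)]
    let B₂ : List ℤ := List.replicate (q * (k + 1) - 1) 1 ++ [(q : ℤ)]
    let C₂ : List ℤ :=
      List.replicate (q * (k + 1)) (p : ℤ) ++ List.replicate (p * q * (k + 1) - 2) 1 ++ [(p : ℤ)]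
    let A₂ : List ℤ :=
      List.replicate (p * (k + 1) - 1) 1 ++
        List.replicate ((p * q - 1) * (k + 1) - 1) (p : ℤ) ++ [(p : ℤ) * q]
    let A₃ : List ℤ :=
      List.replicate (q * (k + 1) - 1) 1 ++
        List.replicate ((p * q - 1) * (k + 1) - 1) (q : ℤ) ++ [(p : ℤ) * q]
    UnimodularlyEquivalent Δ (simplexA A₁) ∨
    UnimodularlyEquivalent Δ (simplexA A₂) ∨
    UnimodularlyEquivalent Δ (simplexA A₃) ∨
    UnimodularlyEquivalent Δ (simplexBC B₁ C₁) ∨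
    UnimodularlyEquivalent Δ (simplexBC B₂ C₂) := by
  exact corollary3p7_general p q k d hp hq Δ hΔ hδ hpyr
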